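/- Let $n\ge 2$ and let $\tilde S_n$ be the affine symmetric group: the bijections $w:\mathbb Z\to\mathbb Z$ with $w(i+n)=w(i)+n$ and $\sum_{i=1}^n w(i)=\sum_{i=1}^n i$, with simple reflections $s_i$ ($i\in\mathbb Z/n$), length $\ell$, and reflections $t_{r,s}$ ($r\not\equiv s \bmod n$) exchanging $r+kn$ and $s+kn$ for all $k$. Write $v\lessdot w$ if $w=vt$ for a reflection $t$ and $\ell(w)=\ell(v)+1$. For $r\in\mathbb Z$ let $\Psi^+_r(v)$ be the set of $w\gtrdot v$ of the form $w=vt_{r,s}$ with $r<s$, and $\Psi^-_r(v)$ the set of $w\gtrdot v$ of the form $w=vt_{s,r}$ with $s<r$. A reduced word is cyclically decreasing if its letters are distinct and, whenever $i$ and $i+1$ (mod $n$) both occur, $i+1$ occurs before $i$; an element is cyclically decreasing if it has such a reduced word. For a proper subset $A\subsetneq\mathbb Z/n$ let $w(A)$ be the element given by any cyclically decreasing word with underlying set $A$. For $\alpha=(\alpha_1,\dots,\alpha_m)\in\mathbb Z_{\ge0}^m$, an $\alpha$-decomposition of $w$ (where $\sum_k\alpha_k=\ell(w)$) is a tuple $(w^1,\dots,w^m)$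 of cyclically decreasing elements with $\ell(w^k)=\alpha_k$ and $w=w^1\cdots w^m$. For cyclically decreasing $u\lessdot w$ with $w=w(A)$, $u=w(A\setminus\{i\})$, let $j\ge0$ be maximal with $i,i-1,\dots,i-j\in A$ and put $\phi^u(w)=w\big((A\setminus\{i\})\cup\{i-j-1\}\big)$. Generalized affine Little algorithm. Input: an $\alpha$-decomposition $(y^1,\dots,y^m)$ of some $w\in\Psi^+_r(v)$. Let $i$ be the index such that $v=y^1\cdots(y^i)'\cdots y^m$, where $(y^i)'$ is obtained from $y^i$ by removing a single simple reflection. Repeat: replace $y^i$ by $\phi^{(y^i)'}(y^i)$; if the new tuple is an $\alpha$-decomposition of some element, stop and output it; otherwise replace $i$ by the index $j\neq i$ such that removing a single simple reflection from the (new) $j$-th factor gives $v$. Theorem. Let $v\in\tilde S_n$, $r\in\mathbb Z$, and $\alpha\in\mathbb Z_{\ge0}^m$. (1) The map $\phi$ on cyclically decreasing elements is well defined and is compatible with the affine Little algorithm on words. Let $u\lessdot w$ be cyclically decreasing. The affine Little algorithm $\phi^u$ on $u$-marked words (pairs of a word and a distinguished letter whose omission leaves a reduced word for $u$) lowers the marked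 letter by $1$ mod $n$, moves the mark to the unique other letter whose omission leaves a reduced word for $u$ if the resulting word is not reduced, and repeats until the word is reduced. If it takes a cyclically decreasing marked reduced word for $w$ to a cyclically decreasing marked reduced word for $w'$, then $w'=\phi^u(w)$; such words exist whenever $\ell(w)\le n-2$. (2) The generalized affine Little algorithm is well defined: the initial index is unique, and each step is uniquely determined at every tuple of cyclically decreasing elements of lengths $\alpha_1,\dots,\alpha_m$, where $\sum_k\alpha_k=\ell(v)+1$, with a distinguished index $i$ such that removing a single simple reflection from the $i$-th factor gives $v$. (3) The algorithm terminates on every input, and input $\mapsto$ output is a bijection from the set of $\alpha$-decompositions of elements of $\Psi^+_r(v)$ onto the set of $\alpha$-decompositions of elements of $\Psi^-_r(v)$. -/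

import Mathlib

/-! ### The affine symmetric group -/

/-- A bijection of `ℤ` commuting with the shift by `n` permutes the residues modulo `n`, so
sums of `n`-periodic functions over a window are not changed by it. -/
theorem sum_window_comp (n : ℕ) (u : Equiv.Perm ℤ) (hu : ∀ i, u (i + n) = u i + n)
    (f : ℤ → ℤ) (hf : ∀ i j, i ≡ j [ZMOD n] → f i = f j) :
    ∑ i ∈ Finset.Icc (1 : ℤ) n, f (u i) = ∑ i ∈ Finset.Icc (1 : ℤ) n, f i := by
  rcases Nat.eq_zero_or_pos n with h0 | hpos
  · subst h0; simp
  have hn : (0 : ℤ) < n := by exact_mod_cast hpos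
  have hk : ∀ (k : ℤ) (i : ℤ), u (i + k * n) = u i + k * n := by
    intro k
    induction k using Int.induction_on with
    | zero => intro i; simp
    | succ k ih =>
      intro i
      have h1 : i + ((k : ℤ) + 1) * n = (i + k * n) + n := by ring
      rw [h1, hu, ih]; ring
    | pred k ih =>
      intro i
      have h1 := hu (i + (-(k : ℤ) - 1) * n)
      have h2 : i + (-(k : ℤ) - 1) * n + n = i + -(k : ℤ) * n := by ring
      rw [h2, ih] at h1
      linarith
  let e : ℤ → ℤ := fun i => (u i - 1) % n + 1
  have hmod : ∀ i, e i ≡ u i [ZMOD n] := by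
    intro i
    have h := (Int.mod_modEq (u i - 1) n).add_right 1
    simpa [e] using h
  have hmem : ∀ i ∈ Finset.Icc (1 : ℤ) n, e i ∈ Finset.Icc (1 : ℤ) n := by
    intro i _
    have h1 := Int.emod_nonneg (u i - 1) hn.ne'
    have h2 := Int.emod_lt_of_pos (u i - 1) hn
    simp only [e, Finset.mem_Icc]
    omega
  have hinj : Set.InjOn e (Finset.Icc (1 : ℤ) n) := by
    intro i hi j hj hij
    have h1 : u i ≡ u j [ZMOD n] := (hmod i).symm.trans (hij ▸ hmod j)
    obtain ⟨k, hk'⟩ := (Int.modEq_iff_dvd.mp h1)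
    have h2 : u j = u (i + k * n) := by rw [hk]; linarith
    have h3 : j = i + k * n := u.injective h2
    simp only [Finset.coe_Icc, Set.mem_Icc] at hi hj
    have hk0 : k = 0 := by
      by_contra hne
      rcases lt_or_gt_of_ne hne with h | h
      · have : k * n ≤ -1 * n := mul_le_mul_of_nonneg_right (by omega) hn.le
        linarith
      · have : 1 * (n : ℤ) ≤ k * n := mul_le_mul_of_nonneg_right (by omega) hn.le
        linarith
    simp [h3, hk0]
  have himg : (Finset.Icc (1 : ℤ) n).image e = Finset.Icc (1 : ℤ) n := by
    apply Finset.eq_of_subset_of_card_le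
    · intro x hx
      obtain ⟨i, hi, rfl⟩ := Finset.mem_image.mp hx
      exact hmem i hi
    · rw [Finset.card_image_of_injOn hinj]
  calc ∑ i ∈ Finset.Icc (1 : ℤ) n, f (u i)
      = ∑ i ∈ Finset.Icc (1 : ℤ) n, f (e i) :=
        Finset.sum_congr rfl (fun i _ => hf _ _ (hmod i).symm)
    _ = ∑ i ∈ (Finset.Icc (1 : ℤ) n).image e, f i := (Finset.sum_image hinj).symm
    _ = _ := by rw [himg]

/-- A map commuting with the shift by `n` has an `n`-periodic displacement. -/
theorem displacement_periodic (n : ℕ) (w : ℤ → ℤ) (hw : ∀ i, w (i + n) = w i + n)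
    (i j : ℤ) (h : i ≡ j [ZMOD n]) : w i - i = w j - j := by
  obtain ⟨k, hk⟩ := Int.modEq_iff_dvd.mp h
  have key : ∀ (k : ℤ) (i : ℤ), w (i + k * n) = w i + k * n := by
    intro k
    induction k using Int.induction_on with
    | zero => intro i; simp
    | succ k ih =>
      intro i
      have h1 : i + ((k : ℤ) + 1) * n = (i + k * n) + n := by ring
      rw [h1, hw, ih]; ring
    | pred k ih =>
      intro i
      have h1 := hw (i + (-(k : ℤ) - 1) * n)
      have h2 : i + (-(k : ℤ) - 1) * n + n = i + -(k : ℤ) * n := by ring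
      rw [h2, ih] at h1
      linarith
  have hj : j = i + k * n := by linarith
  rw [hj, key]; ring

/-- The affine symmetric group: bijections `w` of `ℤ` with `w (i + n) = w i + n` and
`w 1 + ⋯ + w n = 1 + ⋯ + n`. The product is composition of functions. -/
def affineSymmetricGroup (n : ℕ) : Subgroup (Equiv.Perm ℤ) where
  carrier := {w | (∀ i, w (i + n) = w i + n) ∧
    ∑ i ∈ Finset.Icc (1 : ℤ) n, w i = ∑ i ∈ Finset.Icc (1 : ℤ) n, i}
  one_mem' := by simp
  mul_mem' := by
    rintro a b ⟨ha, ha2⟩ ⟨hb, hb2⟩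
    refine ⟨fun i => by simp [hb, ha], ?_⟩
    have h := sum_window_comp n b hb (fun i => a i - i) (displacement_periodic n a ha)
    simp only [Finset.sum_sub_distrib] at h
    simp only [Equiv.Perm.coe_mul, Function.comp_apply]
    linarith
  inv_mem' := by
    rintro a ⟨ha, ha2⟩
    have hb : ∀ i, a⁻¹ (i + n) = a⁻¹ i + n := by
      intro i
      rw [Equiv.Perm.inv_eq_iff_eq, ha]
      simp
    refine ⟨hb, ?_⟩
    have h := sum_window_comp n a⁻¹ hb (fun i => a i - i) (displacement_periodic n a ha)
    simp only [Finset.sum_sub_distrib] at h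
    have hc : ∀ i, a (a⁻¹ i) = i := fun i => by simp
    simp only [hc] at h
    linarith

/-- The type of affine permutations. -/
abbrev AffinePerm (n : ℕ) : Type := affineSymmetricGroup n

/-- The function underlying `t_{r,s}`: it exchanges `r + k n` and `s + k n` for all `k`. -/
def affTranspFun (n : ℕ) (r s : ℤ) (i : ℤ) : ℤ :=
  if i ≡ r [ZMOD n] then i + (s - r) else if i ≡ s [ZMOD n] then i + (r - s) else i

theorem affTranspFun_involutive (n : ℕ) (r s : ℤ) (h : ¬ r ≡ s [ZMOD n]) :
    Function.Involutive (affTranspFun n r s) := by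
  intro i
  by_cases h1 : i ≡ r [ZMOD n]
  · have h2 : i + (s - r) ≡ s [ZMOD n] := by simpa using h1.add_right (s - r)
    have h3 : ¬ i + (s - r) ≡ r [ZMOD n] := fun h4 => h (h4.symm.trans h2)
    simp only [affTranspFun, h1, h2, h3, if_true, if_false]
    ring
  · by_cases h2 : i ≡ s [ZMOD n]
    · have h3 : i + (r - s) ≡ r [ZMOD n] := by simpa using h2.add_right (r - s)
      simp only [affTranspFun, h1, h2, h3, if_true, if_false]
      ring
    · simp [affTranspFun, h1, h2]

theorem affTranspFun_mem (n : ℕ) (r s : ℤ) (h : ¬ r ≡ s [ZMOD n]) :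
    (affTranspFun_involutive n r s h).toPerm ∈ affineSymmetricGroup n := by
  refine ⟨fun i => ?_, ?_⟩
  · simp only [Function.Involutive.coe_toPerm, affTranspFun, Int.modEq_iff_dvd]
    have e1 : ((n : ℤ) ∣ r - (i + n)) ↔ (n : ℤ) ∣ r - i := by
      rw [← sub_sub]; exact dvd_sub_self_right
    have e2 : ((n : ℤ) ∣ s - (i + n)) ↔ (n : ℤ) ∣ s - i := by
      rw [← sub_sub]; exact dvd_sub_self_right
    simp only [e1, e2]
    split_ifs <;> ring
  · simp only [Function.Involutive.coe_toPerm]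
    have e : ∀ i, affTranspFun n r s i = i + ((s - r) * (if i ≡ r [ZMOD n] then 1 else 0)
        - (s - r) * (if i ≡ s [ZMOD n] then 1 else 0)) := by
      intro i
      by_cases h1 : i ≡ r [ZMOD n]
      · have h2 : ¬ i ≡ s [ZMOD n] := fun h2 => h (h1.symm.trans h2)
        simp [affTranspFun, h1, h2]
      · by_cases h2 : i ≡ s [ZMOD n] <;> simp [affTranspFun, h1, h2]
    have hs := sum_window_comp n (Equiv.addRight (s - r)) (fun i => by simp; ring)
      (fun i => if i ≡ s [ZMOD n] then 1 else 0)
      (fun i j hij => by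
        have : i ≡ s [ZMOD n] ↔ j ≡ s [ZMOD n] := ⟨hij.symm.trans, hij.trans⟩
        simp [this])
    have hr : ∀ i : ℤ, (i + (s - r) ≡ s [ZMOD n]) ↔ (i ≡ r [ZMOD n]) := by
      intro i
      constructor
      · intro h1
        have h2 := h1.add_right (r - s)
        ring_nf at h2
        exact h2
      · intro h1
        have h2 := h1.add_right (s - r)
        ring_nf at h2 ⊢
        exact h2
    simp only [Equiv.coe_addRight, hr] at hs
    simp only [e, Finset.sum_add_distrib, Finset.sum_sub_distrib, ← Finset.mul_sum, hs]
    ring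

/-- The reflection `t_{r,s}`, meaningful for `r ≢ s` modulo `n` (by convention `1` otherwise). -/
def affTransp (n : ℕ) (r s : ℤ) : AffinePerm n :=
  if h : r ≡ s [ZMOD n] then 1
  else ⟨(affTranspFun_involutive n r s h).toPerm, affTranspFun_mem n r s h⟩

/-- The simple reflection `s_i = t_{i,i+1}` for `i ∈ ℤ/nℤ`. -/
def simpleRefl (n : ℕ) (i : ZMod n) : AffinePerm n := affTransp n i.cast (i.cast + 1)

/-! ### Words, length, covers -/

/-- The product `s_{a_1} ⋯ s_{a_l}`. -/
def wordProd {n : ℕ} (a : List (ZMod n)) : AffinePerm n := (a.map (simpleRefl n)).prod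

/-- The length of an affine permutation. -/
noncomputable def affLength {n : ℕ} (w : AffinePerm n) : ℕ :=
  sInf {l | ∃ a : List (ZMod n), wordProd a = w ∧ a.length = l}

/-- `a ∈ R(w)`. -/
def IsReducedWordOf {n : ℕ} (a : List (ZMod n)) (w : AffinePerm n) : Prop :=
  wordProd a = w ∧ ∀ b : List (ZMod n), wordProd b = w → a.length ≤ b.length

/-- `a` is a reduced word for some affine permutation. -/
def IsReducedWord {n : ℕ} (a : List (ZMod n)) : Prop := ∃ w, IsReducedWordOf a w

/-- The cover relation `v ⋖ w` of the strong Bruhat order. -/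
def BruhatCovers {n : ℕ} (v w : AffinePerm n) : Prop :=
  (∃ p q : ℤ, ¬ p ≡ q [ZMOD n] ∧ w = v * affTransp n p q) ∧ affLength w = affLength v + 1

/-- `Ψ⁺_r(v)`, the right `r`-covers of `v`. -/
def rightCovers {n : ℕ} (r : ℤ) (v : AffinePerm n) : Set (AffinePerm n) :=
  {w | BruhatCovers v w ∧ ∃ s : ℤ, r < s ∧ ¬ r ≡ s [ZMOD n] ∧ w = v * affTransp n r s}

/-- `Ψ⁻_r(v)`, the left `r`-covers of `v`. -/
def leftCovers {n : ℕ} (r : ℤ) (v : AffinePerm n) : Set (AffinePerm n) :=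
  {w | BruhatCovers v w ∧ ∃ s : ℤ, s < r ∧ ¬ s ≡ r [ZMOD n] ∧ w = v * affTransp n s r}

/-! ### Cyclically decreasing permutations and `α`-decompositions -/

/-- Cyclically decreasing words. -/
def IsCycDecWord {n : ℕ} (a : List (ZMod n)) : Prop :=
  IsReducedWord a ∧ a.Nodup ∧ ∀ i, i ∈ a → i + 1 ∈ a → a.idxOf (i + 1) < a.idxOf i

/-- Cyclically decreasing affine permutations. -/
def IsCycDec {n : ℕ} (w : AffinePerm n) : Prop :=
  ∃ a : List (ZMod n), IsReducedWordOf a w ∧ IsCycDecWord a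

/-- `w = w(A)`: some cyclically decreasing word with underlying set `A` is a word for `w`. -/
def IsCycDecOn {n : ℕ} (A : Finset (ZMod n)) (w : AffinePerm n) : Prop :=
  ∃ a : List (ZMod n), IsCycDecWord a ∧ wordProd a = w ∧ a.toFinset = A

/-- `D = (w^1, …, w^m)` is an `α`-decomposition of `w`. -/
def IsAlphaDecomp {n m : ℕ} (α : Fin m → ℕ) (w : AffinePerm n)
    (D : Fin m → AffinePerm n) : Prop :=
  ∑ k, α k = affLength w ∧ (∀ k, IsCycDec (D k) ∧ affLength (D k) = α k) ∧
    (List.ofFn D).prod = w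

/-- The `α`-decompositions of the elements of a set `S` of affine permutations. -/
def alphaDecomps {n m : ℕ} (α : Fin m → ℕ) (S : Set (AffinePerm n)) :
    Set (Fin m → AffinePerm n) :=
  {D | ∃ w ∈ S, IsAlphaDecomp α w D}

/-! ### The affine Little algorithm on words -/

/-- `FirstHit R P x z`: following `R` for at least one step from `x`, the first vertex with
property `P` that is reached is `z`. -/
inductive FirstHit {X : Type} (R : X → X → Prop) (P : X → Prop) : X → X → Prop
  | hit {x y : X} : R x y → P y → FirstHit R P x y
  | next {x y z : X} : R x y → ¬ P y → FirstHit R P y z → FirstHit R P x z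

/-- A word with the (zero-based) index of a distinguished letter. -/
structure MarkedWord (n : ℕ) where
  word : List (ZMod n)
  idx : ℕ

/-- `(a, i)` is a `v`-marked word: omitting the distinguished letter leaves a reduced word
for `v`. -/
def IsVMarked {n : ℕ} (v : AffinePerm n) (x : MarkedWord n) : Prop :=
  x.idx < x.word.length ∧ IsReducedWordOf (x.word.eraseIdx x.idx) v

/-- The edges of the affine Little graph of `v`. -/
def LittleEdge {n : ℕ} (v : AffinePerm n) (x y : MarkedWord n) : Prop :=
  IsVMarked v x ∧ IsVMarked v y ∧ y.word = x.word.modify x.idx (fun t => t - 1) ∧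
    ((IsReducedWord y.word ∧ y.idx = x.idx) ∨ (¬ IsReducedWord y.word ∧ y.idx ≠ x.idx))

/-- The affine Little algorithm `φ^v` on reduced `v`-marked words: `φ^v x = y`. -/
def LittlePhi {n : ℕ} (v : AffinePerm n) (x y : MarkedWord n) : Prop :=
  IsReducedWord x.word ∧ FirstHit (LittleEdge v) (fun z => IsReducedWord z.word) x y

/-- `φ^v` takes some cyclically decreasing `v`-marked reduced word for `w` to a cyclically
decreasing `v`-marked reduced word for `u`. -/
def CycLittle {n : ℕ} (v w u : AffinePerm n) : Prop :=
  ∃ x y : MarkedWord n, LittlePhi v x y ∧ IsCycDecWord x.word ∧ wordProd x.word = w ∧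
    IsCycDecWord y.word ∧ wordProd y.word = u

/-! ### The generalized affine Little algorithm -/

/-- The map `w ↦ φ^v w = u` on the cyclically decreasing covers of a cyclically decreasing `v`:
if `w = w(A)`, `v = w(A - {i})` and `j` is maximal with `i, i - 1, …, i - j ∈ A`, then
`u = w(A - {i} ∪ {i - j - 1})`. -/
def CycPhi {n : ℕ} (v w u : AffinePerm n) : Prop :=
  ∃ (A : Finset (ZMod n)) (i : ZMod n) (j : ℕ), i ∈ A ∧ IsCycDecOn A w ∧
    IsCycDecOn (A.erase i) v ∧ (∀ k : ℕ, k ≤ j → i - (k : ZMod n) ∈ A) ∧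
    i - (j : ZMod n) - 1 ∉ A ∧ IsCycDecOn (insert (i - (j : ZMod n) - 1) (A.erase i)) u

/-- `u` is obtained from `y` by removing a single simple reflection (from a reduced word). -/
def RemovesOne {n : ℕ} (y u : AffinePerm n) : Prop :=
  ∃ (a : List (ZMod n)) (p : ℕ), p < a.length ∧ IsReducedWordOf a y ∧
    IsReducedWordOf (a.eraseIdx p) u

/-- The data `(y^1, …, y^m)` and `i` handled by the algorithm. -/
structure LittleState (n m : ℕ) where
  factors : Fin m → AffinePerm n
  idx : Fin m

/-- `u = (y^i)'` is obtained from `y^i` by removing a single simple reflection, and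
`v = y^1 ⋯ (y^i)' ⋯ y^m`. -/
def IsMarkedBy {n m : ℕ} (v : AffinePerm n) (S : LittleState n m) (u : AffinePerm n) : Prop :=
  RemovesOne (S.factors S.idx) u ∧
    (List.ofFn (Function.update S.factors S.idx u)).prod = v

/-- The states of the algorithm: cyclically decreasing factors of lengths `α_1, …, α_m` (with
`α_1 + ⋯ + α_m = ℓ(v) + 1`), whose product need not be reduced, such that removing a single
simple reflection from the factor with the distinguished index gives `v`. -/
def IsLittleState {n m : ℕ} (α : Fin m → ℕ) (v : AffinePerm n) (S : LittleState n m) : Prop :=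
  ∑ k, α k = affLength v + 1 ∧ (∀ k, IsCycDec (S.factors k) ∧ affLength (S.factors k) = α k) ∧
    ∃ u, IsMarkedBy v S u

/-- The factors form an `α`-decomposition of some affine permutation. -/
def IsTerminal {n m : ℕ} (α : Fin m → ℕ) (S : LittleState n m) : Prop :=
  ∃ w, IsAlphaDecomp α w S.factors

/-- One pass of the loop: replace `y^i` by `φ^{(y^i)'}(y^i)`; if the result is an
`α`-decomposition, keep `i` (the algorithm then stops), otherwise move to an index `j ≠ i` such
that removing a single simple reflection from the `j`-th factor gives `v`. -/
def LittleStep {n m : ℕ} (α : Fin m → ℕ) (v : AffinePerm n) (S T : LittleState n m) : Prop :=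
  ∃ u z : AffinePerm n, IsMarkedBy v S u ∧ CycPhi u (S.factors S.idx) z ∧
    T.factors = Function.update S.factors S.idx z ∧
    ((IsTerminal α T ∧ T.idx = S.idx) ∨
      (¬ IsTerminal α T ∧ T.idx ≠ S.idx ∧ ∃ u', IsMarkedBy v T u'))

/-- The generalized affine Little algorithm for `v`, started on the `α`-decomposition `D`,
terminates with output `E`. -/
def LittleOutput {n m : ℕ} (α : Fin m → ℕ) (v : AffinePerm n)
    (D E : Fin m → AffinePerm n) : Prop :=
  ∃ i j : Fin m, IsLittleState α v ⟨D, i⟩ ∧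
    FirstHit (LittleStep α v) (IsTerminal α) ⟨D, i⟩ ⟨E, j⟩

/-! ### Affine permutations and reflections -/

section Basics

variable {n : ℕ}

/-! Read a product of factors from right to left as a wiring diagram, in which the wire `r` starts
at the integer `r` on the right. A mark, that is, a factor that can be lowered by one cover so that
the product becomes `v`, is the same thing as a crossing at that factor of two wires whose exchange
turns the product into `v` (`WirePair`). All marks of one list come from one reflection, since it is
fixed by the product and `v`.

Each crossing of two wires can be removed at the cost of at least one unit of length
(`affLength_prod_mul_pow_le`). As the factor lengths add up to `ℓ(v) + 1`, three crossings of the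
exchanged wires are impossible, and two are impossible when the factors are length additive. If they
are not additive, parity gives `ℓ(L.prod) < ℓ(v)`. The two wires then have the same order at both
ends, so the known crossing is accompanied by one of opposite orientation (`WirePair.exists_ne`).
Hence the initial index is unique and each step is forced.

For cyclically decreasing factors, an explicit formula for `w(A)` shows that inserting the letter
`i` with run `i, …, i - j` multiplies by `t_{i-j,i+1}` (`IsCycFun.run`). So `φ` replaces `u t_{c,e}`
with `u t_{d,c}`, where `d < c < e`: the lower exchanged wire becomes the upper one
(`CycPhi.exists_affTransp`). If the algorithm goes on, the second crossing has this wire as its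
lower wire again. One wire `r` is thus preserved throughout: at the start it is the smaller index of
the reflection, which gives a right `r`-cover, and at the end the larger one, which gives a left
`r`-cover.

A step is also injective, so it permutes the finite set of states, and the first return map to the
terminal states is a bijection. The class of `r` modulo `n` can be read from the product of a
terminal state, so this bijection restricts to the `r`-covers. The algorithm on words fits the same
picture with simple reflections as factors; following the wire `r` identifies its result with `φ`.
-/

theorem AffinePerm.ext_apply {v w : AffinePerm n} (h : ∀ x, v.1 x = w.1 x) : v = w :=
  Subtype.ext (Equiv.ext h)

theorem AffinePerm.mul_apply (v w : AffinePerm n) (x : ℤ) : (v * w).1 x = v.1 (w.1 x) := rfl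

theorem AffinePerm.one_apply (x : ℤ) : (1 : AffinePerm n).1 x = x := rfl

theorem AffinePerm.inv_apply_self (w : AffinePerm n) (x : ℤ) : (w⁻¹).1 (w.1 x) = x := by
  rw [← AffinePerm.mul_apply]; simp

theorem AffinePerm.apply_inv_self (w : AffinePerm n) (x : ℤ) : w.1 ((w⁻¹).1 x) = x := by
  rw [← AffinePerm.mul_apply]; simp

theorem AffinePerm.apply_add_mul (w : AffinePerm n) (x k : ℤ) :
    w.1 (x + k * n) = w.1 x + k * n := by
  have h := displacement_periodic n w.1 w.2.1 x (x + k * n)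
    (Int.modEq_iff_dvd.mpr ⟨k, by ring⟩)
  linarith

theorem Int.modEq_iff_exists_add_mul {x y : ℤ} :
    x ≡ y [ZMOD n] ↔ ∃ k : ℤ, y = x + k * n := by
  rw [Int.modEq_iff_dvd]
  exact ⟨fun ⟨k, hk⟩ => ⟨k, by linarith⟩, fun ⟨k, hk⟩ => ⟨k, by rw [hk]; ring⟩⟩

theorem AffinePerm.apply_modEq (w : AffinePerm n) {x y : ℤ} (h : x ≡ y [ZMOD n]) :
    w.1 x ≡ w.1 y [ZMOD n] := by
  obtain ⟨k, rfl⟩ := Int.modEq_iff_exists_add_mul.mp h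
  rw [w.apply_add_mul]
  exact Int.modEq_iff_exists_add_mul.mpr ⟨k, rfl⟩

theorem AffinePerm.apply_modEq_iff (w : AffinePerm n) {x y : ℤ} :
    w.1 x ≡ w.1 y [ZMOD n] ↔ x ≡ y [ZMOD n] :=
  ⟨fun h => by simpa only [AffinePerm.inv_apply_self] using (w⁻¹).apply_modEq h, w.apply_modEq⟩

theorem affTransp_apply {r s : ℤ} (h : ¬ r ≡ s [ZMOD n]) (x : ℤ) :
    (affTransp n r s).1 x = affTranspFun n r s x := by
  simp [affTransp, h]

theorem affTransp_apply_of_modEq_left {r s x : ℤ} (h : ¬ r ≡ s [ZMOD n])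
    (hx : x ≡ r [ZMOD n]) : (affTransp n r s).1 x = x + (s - r) := by
  simp [affTransp_apply h, affTranspFun, hx]

theorem affTransp_apply_of_modEq_right {r s x : ℤ} (h : ¬ r ≡ s [ZMOD n])
    (hx : x ≡ s [ZMOD n]) : (affTransp n r s).1 x = x + (r - s) := by
  have h' : ¬ x ≡ r [ZMOD n] := fun h' => h (h'.symm.trans hx)
  simp only [affTransp_apply h, affTranspFun, hx, h', if_true, if_false]

theorem affTransp_apply_of_ne {r s x : ℤ} (hr : ¬ x ≡ r [ZMOD n])
    (hs : ¬ x ≡ s [ZMOD n]) : (affTransp n r s).1 x = x := by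
  by_cases h : r ≡ s [ZMOD n]
  · simp [affTransp, h]
  · simp only [affTransp_apply h, affTranspFun, hr, hs, if_false]

theorem affTransp_apply_left {r s : ℤ} (h : ¬ r ≡ s [ZMOD n]) : (affTransp n r s).1 r = s := by
  rw [affTransp_apply_of_modEq_left h rfl]; ring

theorem affTransp_apply_right {r s : ℤ} (h : ¬ r ≡ s [ZMOD n]) : (affTransp n r s).1 s = r := by
  rw [affTransp_apply_of_modEq_right h rfl]; ring

theorem affTransp_mul_self (r s : ℤ) : affTransp n r s * affTransp n r s = 1 := by
  by_cases h : r ≡ s [ZMOD n]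
  · simp [affTransp, h]
  · refine AffinePerm.ext_apply fun x => ?_
    rw [AffinePerm.mul_apply, affTransp_apply h, affTransp_apply h, AffinePerm.one_apply]
    exact affTranspFun_involutive n r s h x

theorem mul_affTransp_mul_affTransp (w : AffinePerm n) (r s : ℤ) :
    w * affTransp n r s * affTransp n r s = w := by
  rw [mul_assoc, affTransp_mul_self, mul_one]

theorem mul_affTransp_eq_iff {v w : AffinePerm n} {r s : ℤ} :
    w * affTransp n r s = v ↔ w = v * affTransp n r s :=
  ⟨fun h => by rw [← h, mul_affTransp_mul_affTransp],
    fun h => by rw [h, mul_affTransp_mul_affTransp]⟩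

theorem affTransp_comm (r s : ℤ) : affTransp n r s = affTransp n s r := by
  by_cases h : r ≡ s [ZMOD n]
  · simp [affTransp, h, h.symm]
  · have h' : ¬ s ≡ r [ZMOD n] := fun h' => h h'.symm
    refine AffinePerm.ext_apply fun x => ?_
    by_cases hr : x ≡ r [ZMOD n]
    · rw [affTransp_apply_of_modEq_left h hr, affTransp_apply_of_modEq_right h' hr]
    · by_cases hs : x ≡ s [ZMOD n]
      · rw [affTransp_apply_of_modEq_right h hs, affTransp_apply_of_modEq_left h' hs]
      · rw [affTransp_apply_of_ne hr hs, affTransp_apply_of_ne hs hr]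

/-- Conjugating a reflection moves its indices. -/
theorem mul_affTransp (w : AffinePerm n) (r s : ℤ) :
    w * affTransp n r s = affTransp n (w.1 r) (w.1 s) * w := by
  by_cases h : r ≡ s [ZMOD n]
  · simp [affTransp, h, w.apply_modEq h]
  · have h' : ¬ w.1 r ≡ w.1 s [ZMOD n] := by rwa [w.apply_modEq_iff]
    refine AffinePerm.ext_apply fun x => ?_
    rw [AffinePerm.mul_apply, AffinePerm.mul_apply]
    by_cases hr : x ≡ r [ZMOD n]
    · rw [affTransp_apply_of_modEq_left h hr,
        affTransp_apply_of_modEq_left h' (w.apply_modEq hr)]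
      obtain ⟨k, rfl⟩ := Int.modEq_iff_exists_add_mul.mp hr.symm
      rw [show r + k * n + (s - r) = s + k * n by ring, w.apply_add_mul, w.apply_add_mul]
      ring
    · by_cases hs : x ≡ s [ZMOD n]
      · rw [affTransp_apply_of_modEq_right h hs,
          affTransp_apply_of_modEq_right h' (w.apply_modEq hs)]
        obtain ⟨k, rfl⟩ := Int.modEq_iff_exists_add_mul.mp hs.symm
        rw [show s + k * n + (r - s) = r + k * n by ring, w.apply_add_mul, w.apply_add_mul]
        ring
      · rw [affTransp_apply_of_ne hr hs, affTransp_apply_of_ne]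
        · rwa [w.apply_modEq_iff]
        · rwa [w.apply_modEq_iff]

theorem add_mul_modEq_add_mul {r s k : ℤ} :
    r + k * n ≡ s + k * n [ZMOD n] ↔ r ≡ s [ZMOD n] :=
  ⟨fun h => Int.ModEq.add_right_cancel' _ h, fun h => h.add_right _⟩

theorem affTransp_add_mul (r s k : ℤ) :
    affTransp n (r + k * n) (s + k * n) = affTransp n r s := by
  have hr : r + k * n ≡ r [ZMOD n] := (Int.modEq_iff_exists_add_mul.mpr ⟨k, rfl⟩).symm
  have hs : s + k * n ≡ s [ZMOD n] := (Int.modEq_iff_exists_add_mul.mpr ⟨k, rfl⟩).symm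
  by_cases h : r ≡ s [ZMOD n]
  · simp [affTransp, h]
  · have h' : ¬ r + k * n ≡ s + k * n [ZMOD n] := by rwa [add_mul_modEq_add_mul]
    refine AffinePerm.ext_apply fun x => ?_
    by_cases hxr : x ≡ r [ZMOD n]
    · rw [affTransp_apply_of_modEq_left h hxr,
        affTransp_apply_of_modEq_left h' (hxr.trans hr.symm)]
      ring
    · by_cases hxs : x ≡ s [ZMOD n]
      · rw [affTransp_apply_of_modEq_right h hxs,
          affTransp_apply_of_modEq_right h' (hxs.trans hs.symm)]
        ring
      · rw [affTransp_apply_of_ne hxr hxs,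
          affTransp_apply_of_ne (fun h => hxr (h.trans hr)) (fun h => hxs (h.trans hs))]

/-- The increasing pair of indices of a reflection is unique up to a shift. -/
theorem affTransp_eq_iff {r s r' s' : ℤ} (h : ¬ r ≡ s [ZMOD n]) (h' : ¬ r' ≡ s' [ZMOD n])
    (hlt : r < s) (hlt' : r' < s') :
    affTransp n r s = affTransp n r' s' ↔ ∃ k : ℤ, r' = r + k * n ∧ s' = s + k * n := by
  constructor
  · intro e
    have e1 : (affTransp n r' s').1 r = s := by rw [← e, affTransp_apply_left h]
    by_cases h1 : r ≡ r' [ZMOD n]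
    · rw [affTransp_apply_of_modEq_left h' h1] at e1
      obtain ⟨k, hk⟩ := Int.modEq_iff_exists_add_mul.mp h1
      exact ⟨k, hk, by linarith⟩
    · by_cases h2 : r ≡ s' [ZMOD n]
      · rw [affTransp_apply_of_modEq_right h' h2] at e1
        linarith
      · rw [affTransp_apply_of_ne h1 h2] at e1
        linarith
  · rintro ⟨k, rfl, rfl⟩
    rw [affTransp_add_mul]

/-! ### Words, lifts of residues, and the action on residues -/

theorem wordProd_nil : wordProd ([] : List (ZMod n)) = 1 := rfl

theorem wordProd_cons (i : ZMod n) (a : List (ZMod n)) :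
    wordProd (i :: a) = simpleRefl n i * wordProd a := by
  simp [wordProd]

theorem wordProd_append (a b : List (ZMod n)) :
    wordProd (a ++ b) = wordProd a * wordProd b := by
  simp [wordProd]

theorem disp_cast (w : AffinePerm n) (x : ℤ) :
    w.1 ((x : ZMod n).cast : ℤ) - ((x : ZMod n).cast : ℤ) = w.1 x - x := by
  refine displacement_periodic n w.1 w.2.1 _ _ ?_
  rw [← ZMod.intCast_eq_intCast_iff]; simp

/-- Frees simple reflections from the representative chosen by `ZMod.cast`: later proofs lift a
letter to any convenient integer. -/
theorem simpleRefl_intCast (x : ℤ) : simpleRefl n (x : ZMod n) = affTransp n x (x + 1) := by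
  have h : ((x : ZMod n).cast : ℤ) ≡ x [ZMOD n] := by
    rw [← ZMod.intCast_eq_intCast_iff]; simp
  obtain ⟨k, hk⟩ := Int.modEq_iff_exists_add_mul.mp h
  have e := affTransp_add_mul (n := n) ((x : ZMod n).cast : ℤ) (((x : ZMod n).cast : ℤ) + 1) k
  rwa [add_right_comm, ← hk, eq_comm] at e

/-- The permutation of the residues induced by an affine permutation. -/
def residuePerm : AffinePerm n →* Equiv.Perm (ZMod n) :=
  MonoidHom.toHomPerm
    { toFun := fun w i => ((w.1 i.cast : ℤ) : ZMod n)
      map_one' := by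
        funext i
        change ((i.cast : ℤ) : ZMod n) = i
        simp
      map_mul' := by
        intro v w
        funext i
        simp only [AffinePerm.mul_apply]
        change _ = ((v.1 (((w.1 i.cast : ℤ) : ZMod n).cast) : ℤ) : ZMod n)
        rw [ZMod.intCast_eq_intCast_iff]
        refine v.apply_modEq ?_
        rw [← ZMod.intCast_eq_intCast_iff]; simp }

theorem residuePerm_intCast (w : AffinePerm n) (x : ℤ) :
    residuePerm w (x : ZMod n) = ((w.1 x : ℤ) : ZMod n) := by
  change ((w.1 ((x : ZMod n).cast : ℤ) : ℤ) : ZMod n) = _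
  rw [ZMod.intCast_eq_intCast_iff]
  refine w.apply_modEq ?_
  rw [← ZMod.intCast_eq_intCast_iff]; simp

end Basics

/-! ### Generation by simple reflections, and the sign -/

section Generation

variable {n : ℕ} [Fact (1 < n)]

theorem not_modEq_add_one (x : ℤ) : ¬ x ≡ x + 1 [ZMOD n] := by
  have hn : 1 < n := Fact.out
  intro h
  have h1 := Int.modEq_iff_dvd.mp h
  have h2 := Int.le_of_dvd (by norm_num) h1
  omega

/-- The sum of the squared displacements over a window. -/
def dispSq (w : AffinePerm n) : ℤ := ∑ i : ZMod n, (w.1 i.cast - i.cast) ^ 2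

theorem dispSq_nonneg (w : AffinePerm n) : 0 ≤ dispSq w :=
  Finset.sum_nonneg fun _ _ => sq_nonneg _

theorem intCast_ne_add_one (x : ℤ) : (x : ZMod n) ≠ ((x + 1 : ℤ) : ZMod n) := by
  rw [Ne, ZMod.intCast_eq_intCast_iff]
  exact not_modEq_add_one x

/-- Only the summands of the classes of `x` and `x + 1` change. At a descent the sum drops, so it
serves as the measure for sorting `w` to the identity in `exists_wordProd_eq`. -/
theorem dispSq_mul_simpleRefl (w : AffinePerm n) (x : ℤ) :
    dispSq (w * affTransp n x (x + 1)) = dispSq w + 2 * (w.1 (x + 1) - w.1 x) := by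
  have hne := intCast_ne_add_one (n := n) x
  have split : ∀ f : ZMod n → ℤ, ∑ i, f i = f (x : ZMod n) + f ((x + 1 : ℤ) : ZMod n) +
      ∑ i ∈ (Finset.univ.erase (x : ZMod n)).erase ((x + 1 : ℤ) : ZMod n), f i := by
    intro f
    rw [← Finset.add_sum_erase Finset.univ f (Finset.mem_univ (x : ZMod n)),
      ← Finset.add_sum_erase (Finset.univ.erase (x : ZMod n)) f
        (Finset.mem_erase.mpr ⟨hne.symm, Finset.mem_univ _⟩)]
    ring
  rw [dispSq, dispSq, split, split]
  simp only [disp_cast]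
  have h3 : ∑ i ∈ (Finset.univ.erase (x : ZMod n)).erase ((x + 1 : ℤ) : ZMod n),
      ((w * affTransp n x (x + 1)).1 i.cast - (i.cast : ℤ)) ^ 2 =
      ∑ i ∈ (Finset.univ.erase (x : ZMod n)).erase ((x + 1 : ℤ) : ZMod n),
      (w.1 i.cast - (i.cast : ℤ)) ^ 2 := by
    refine Finset.sum_congr rfl fun i hi => ?_
    simp only [Finset.mem_erase, Finset.mem_univ, and_true] at hi
    rw [AffinePerm.mul_apply, affTransp_apply_of_ne]
    · rw [← ZMod.intCast_eq_intCast_iff]; simpa using hi.2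
    · rw [← ZMod.intCast_eq_intCast_iff]; simpa using hi.1
  rw [h3, AffinePerm.mul_apply, AffinePerm.mul_apply,
    affTransp_apply_left (not_modEq_add_one x), affTransp_apply_right (not_modEq_add_one x)]
  ring

/-- An increasing bijection of `ℤ` skips no value, so it is a translation; the normalization of the
window sum makes the translation trivial. -/
theorem AffinePerm.eq_one_of_no_descent (w : AffinePerm n)
    (h : ∀ x, w.1 x < w.1 (x + 1)) : w = 1 := by
  have hmono : StrictMono w.1 := strictMono_int_of_lt_succ h
  have hstep : ∀ x, w.1 (x + 1) = w.1 x + 1 := by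
    intro x
    by_contra hne
    have hlt := h x
    have hy := w.apply_inv_self (w.1 x + 1)
    set y := (w⁻¹).1 (w.1 x + 1)
    have h1 : x < y := hmono.lt_iff_lt.mp (by omega)
    have h2 : y < x + 1 := hmono.lt_iff_lt.mp (by omega)
    omega
  have hshift : ∀ x, w.1 x = w.1 0 + x := by
    intro x
    induction x using Int.induction_on with
    | zero => simp
    | succ k ih => rw [hstep, ih]; ring
    | pred k ih =>
      have := hstep (-(k : ℤ) - 1)
      rw [sub_add_cancel, ih] at this
      linarith
  have hsum := w.2.2
  have hn : 1 < n := Fact.out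
  rw [Finset.sum_congr rfl (fun i _ => hshift i), Finset.sum_add_distrib] at hsum
  have h0 : w.1 0 = 0 := by
    simp at hsum
    omega
  exact AffinePerm.ext_apply fun x => by rw [hshift, h0, AffinePerm.one_apply, zero_add]

theorem exists_wordProd_eq (w : AffinePerm n) : ∃ a : List (ZMod n), wordProd a = w := by
  induction hN : (dispSq w).toNat using Nat.strong_induction_on generalizing w with
  | _ N ih =>
    by_cases h : ∀ x, w.1 x < w.1 (x + 1)
    · exact ⟨[], by rw [w.eq_one_of_no_descent h, wordProd_nil]⟩
    · push Not at h
      obtain ⟨x, hx⟩ := h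
      have hne : w.1 (x + 1) ≠ w.1 x := fun h => by simpa using w.1.injective h
      have h1 := dispSq_mul_simpleRefl w x
      have h2 := dispSq_nonneg (w * affTransp n x (x + 1))
      obtain ⟨a, ha⟩ := ih _ (by omega) (w * affTransp n x (x + 1)) rfl
      refine ⟨a ++ [(x : ZMod n)], ?_⟩
      rw [wordProd_append, ha, wordProd_cons, wordProd_nil, mul_one, simpleRefl_intCast,
        mul_affTransp_mul_affTransp]

/-- A reflection acts on residues as a transposition. The sign of the residue permutation therefore
detects the parity of the length. -/
theorem sign_residuePerm_affTransp {r s : ℤ} (h : ¬ r ≡ s [ZMOD n]) :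
    Equiv.Perm.sign (residuePerm (affTransp n r s)) = -1 := by
  have hne : (r : ZMod n) ≠ (s : ZMod n) := by rwa [Ne, ZMod.intCast_eq_intCast_iff]
  have : residuePerm (affTransp n r s) = Equiv.swap (r : ZMod n) (s : ZMod n) := by
    ext i
    obtain ⟨x, rfl⟩ := ZMod.intCast_surjective i
    rw [residuePerm_intCast, Equiv.swap_apply_def]
    simp only [ZMod.intCast_eq_intCast_iff]
    split_ifs with h1 h2
    · rw [affTransp_apply_of_modEq_left h h1, ZMod.intCast_eq_intCast_iff]
      simpa using h1.add_right (s - r)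
    · rw [affTransp_apply_of_modEq_right h h2, ZMod.intCast_eq_intCast_iff]
      simpa using h2.add_right (r - s)
    · rw [affTransp_apply_of_ne h1 h2]
  rw [this, Equiv.Perm.sign_swap hne]

theorem sign_residuePerm_wordProd (a : List (ZMod n)) :
    Equiv.Perm.sign (residuePerm (wordProd a)) = (-1) ^ a.length := by
  induction a with
  | nil => simp [wordProd_nil]
  | cons i a ih =>
    obtain ⟨x, rfl⟩ := ZMod.intCast_surjective i
    rw [wordProd_cons, map_mul, map_mul, ih, simpleRefl_intCast,
      sign_residuePerm_affTransp (not_modEq_add_one x), List.length_cons, pow_succ']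

end Generation

/-! ### Length -/

section Length

variable {n : ℕ}

theorem AffinePerm.apply_ne (w : AffinePerm n) {x y : ℤ} (h : ¬ x ≡ y [ZMOD n]) :
    w.1 x ≠ w.1 y := fun e => h (by rw [w.1.injective e])

theorem affLength_wordProd_le (a : List (ZMod n)) : affLength (wordProd a) ≤ a.length :=
  Nat.sInf_le ⟨a, rfl, rfl⟩

theorem affLength_one : affLength (1 : AffinePerm n) = 0 :=
  Nat.le_zero.mp (affLength_wordProd_le ([] : List (ZMod n)))

variable [Fact (1 < n)]

theorem exists_wordProd_eq_length (w : AffinePerm n) :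
    ∃ a : List (ZMod n), wordProd a = w ∧ a.length = affLength w := by
  obtain ⟨a, ha⟩ := exists_wordProd_eq w
  exact Nat.sInf_mem (s := {l | ∃ a : List (ZMod n), wordProd a = w ∧ a.length = l})
    ⟨_, a, ha, rfl⟩

theorem isReducedWordOf_iff {a : List (ZMod n)} {w : AffinePerm n} :
    IsReducedWordOf a w ↔ wordProd a = w ∧ a.length = affLength w := by
  constructor
  · rintro ⟨rfl, h⟩
    obtain ⟨b, hb, hl⟩ := exists_wordProd_eq_length (wordProd a)
    exact ⟨rfl, le_antisymm (hl ▸ h b hb) (affLength_wordProd_le a)⟩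
  · rintro ⟨rfl, h⟩
    exact ⟨rfl, fun b hb => by rw [h, ← hb]; exact affLength_wordProd_le b⟩

theorem isReducedWord_iff {a : List (ZMod n)} :
    IsReducedWord a ↔ a.length = affLength (wordProd a) := by
  constructor
  · rintro ⟨w, hw⟩
    rw [isReducedWordOf_iff] at hw
    rw [hw.1, hw.2]
  · exact fun h => ⟨_, isReducedWordOf_iff.mpr ⟨rfl, h⟩⟩

theorem affLength_mul_le (v w : AffinePerm n) :
    affLength (v * w) ≤ affLength v + affLength w := by
  obtain ⟨a, rfl, ha⟩ := exists_wordProd_eq_length v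
  obtain ⟨b, rfl, hb⟩ := exists_wordProd_eq_length w
  rw [← wordProd_append, ← ha, ← hb, ← List.length_append]
  exact affLength_wordProd_le _

theorem affLength_prod_le (L : List (AffinePerm n)) :
    affLength L.prod ≤ (L.map affLength).sum := by
  induction L with
  | nil => simp [affLength_one]
  | cons g L ih =>
    rw [List.prod_cons, List.map_cons, List.sum_cons]
    exact (affLength_mul_le _ _).trans (by omega)

theorem sign_residuePerm (w : AffinePerm n) :
    Equiv.Perm.sign (residuePerm w) = (-1) ^ affLength w := by
  obtain ⟨a, rfl, ha⟩ := exists_wordProd_eq_length w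
  rw [sign_residuePerm_wordProd, ha]

theorem affLength_mul_affTransp_ne (w : AffinePerm n) {r s : ℤ} (h : ¬ r ≡ s [ZMOD n]) :
    affLength (w * affTransp n r s) % 2 ≠ affLength w % 2 := by
  intro e
  have h1 := sign_residuePerm (w * affTransp n r s)
  rw [map_mul, map_mul, sign_residuePerm_affTransp h, sign_residuePerm] at h1
  have h2 := congrArg Units.val h1
  push_cast at h2
  rw [neg_one_pow_eq_pow_mod_two (affLength (w * affTransp n r s)), e,
    ← neg_one_pow_eq_pow_mod_two] at h2
  rcases neg_one_pow_eq_or ℤ (affLength w) with h3 | h3 <;> rw [h3] at h2 <;> norm_num at h2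

/-! ### The exchange property -/

/-- A simple reflection that changes the order of two values is the reflection exchanging
them. -/
theorem simpleRefl_eq_affTransp {x y : ℤ} (hxy : ¬ x ≡ y [ZMOD n]) (i : ZMod n)
    (h : ¬ (x < y ↔ (simpleRefl n i).1 x < (simpleRefl n i).1 y)) :
    simpleRefl n i = affTransp n x y := by
  obtain ⟨z, rfl⟩ := ZMod.intCast_surjective i
  have hz := not_modEq_add_one (n := n) z
  have hne : x ≠ y := fun e => hxy (by rw [e])
  rw [simpleRefl_intCast] at h ⊢
  have shift : ∀ {a : ℤ}, a ≡ z [ZMOD n] → affTransp n z (z + 1) = affTransp n a (a + 1) := by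
    intro a ha
    obtain ⟨k, hk⟩ := Int.modEq_iff_exists_add_mul.mp ha
    rw [hk, add_right_comm, affTransp_add_mul]
  by_cases hx : x ≡ z [ZMOD n]
  · have hy : ¬ y ≡ z [ZMOD n] := fun h => hxy (hx.trans h.symm)
    rw [affTransp_apply_of_modEq_left hz hx] at h
    by_cases hy' : y ≡ z + 1 [ZMOD n]
    · rw [affTransp_apply_of_modEq_right hz hy'] at h
      have h1 : y ≠ x + 2 := by
        rintro rfl
        have h2 := (hx.add_right 1).trans hy'.symm
        exact not_modEq_add_one (x + 1) (by rwa [add_assoc, one_add_one_eq_two])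
      rw [shift hx, show y = x + 1 by omega]
    · rw [affTransp_apply_of_ne hy hy'] at h
      exact absurd (show y ≡ z + 1 [ZMOD n] by
        rw [show y = x + 1 by omega]; exact hx.add_right 1) hy'
  · by_cases hx' : x ≡ z + 1 [ZMOD n]
    · have hy : ¬ y ≡ z + 1 [ZMOD n] := fun h => hxy (hx'.trans h.symm)
      rw [affTransp_apply_of_modEq_right hz hx'] at h
      by_cases hy' : y ≡ z [ZMOD n]
      · rw [affTransp_apply_of_modEq_left hz hy'] at h
        have h1 : x ≠ y + 2 := by
          rintro rfl
          have h2 := (hy'.add_right 1).trans hx'.symm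
          exact not_modEq_add_one (y + 1) (by rwa [add_assoc, one_add_one_eq_two])
        rw [shift hy', affTransp_comm, show x = y + 1 by omega]
      · rw [affTransp_apply_of_ne hy' hy] at h
        exact absurd (show y ≡ z [ZMOD n] by
          rw [show y = x - 1 by omega]; simpa using hx'.sub_right 1) hy'
    · rw [affTransp_apply_of_ne hx hx'] at h
      by_cases hy : y ≡ z [ZMOD n]
      · rw [affTransp_apply_of_modEq_left hz hy] at h
        exact absurd (show x ≡ z + 1 [ZMOD n] by
          rw [show x = y + 1 by omega]; exact hy.add_right 1) hx'
      · by_cases hy' : y ≡ z + 1 [ZMOD n]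
        · rw [affTransp_apply_of_modEq_right hz hy'] at h
          exact absurd (show x ≡ z [ZMOD n] by
            rw [show x = y - 1 by omega]; simpa using hy'.sub_right 1) hx
        · rw [affTransp_apply_of_ne hy hy'] at h
          exact absurd Iff.rfl h

/-- The strong exchange property. -/
theorem exists_wordProd_eraseIdx (a : List (ZMod n)) {x y : ℤ} (hxy : ¬ x ≡ y [ZMOD n])
    (h : ¬ (x < y ↔ (wordProd a).1 x < (wordProd a).1 y)) :
    ∃ p < a.length, wordProd (a.eraseIdx p) = wordProd a * affTransp n x y := by
  induction a with
  | nil => exact absurd Iff.rfl h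
  | cons i a ih =>
    -- If the suffix keeps the order of `x` and `y`, the first letter reverses it; this letter is
    -- then the reflection in the two images, and moving `t_{x,y}` through the suffix cancels it.
    -- Otherwise the letter to delete lies in the suffix.
    by_cases h1 : x < y ↔ (wordProd a).1 x < (wordProd a).1 y
    · have hxy' : ¬ (wordProd a).1 x ≡ (wordProd a).1 y [ZMOD n] := by
        rwa [AffinePerm.apply_modEq_iff]
      refine ⟨0, by simp, ?_⟩
      rw [wordProd_cons, AffinePerm.mul_apply, AffinePerm.mul_apply, h1] at h
      rw [List.eraseIdx_cons_zero, wordProd_cons, mul_assoc, mul_affTransp,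
        simpleRefl_eq_affTransp hxy' i h, ← mul_assoc, affTransp_mul_self, one_mul]
    · obtain ⟨p, hp, e⟩ := ih h1
      exact ⟨p + 1, by simpa using hp, by
        rw [List.eraseIdx_cons_succ, wordProd_cons, e, wordProd_cons, mul_assoc]⟩

theorem affLength_mul_affTransp_lt_of (w : AffinePerm n) {x y : ℤ} (hxy : ¬ x ≡ y [ZMOD n])
    (h : ¬ (x < y ↔ w.1 x < w.1 y)) : affLength (w * affTransp n x y) < affLength w := by
  obtain ⟨a, rfl, ha⟩ := exists_wordProd_eq_length w
  obtain ⟨p, hp, e⟩ := exists_wordProd_eraseIdx a hxy h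
  rw [← e]
  refine (affLength_wordProd_le _).trans_lt ?_
  rw [List.length_eraseIdx_of_lt hp]
  omega

/-- The missing implication is the exchange property applied to `w t_{x,y}`, where the values at `x`
and `y` are in the other order. -/
theorem affLength_mul_affTransp_lt_iff (w : AffinePerm n) {x y : ℤ}
    (hxy : ¬ x ≡ y [ZMOD n]) :
    affLength (w * affTransp n x y) < affLength w ↔ ¬ (x < y ↔ w.1 x < w.1 y) := by
  refine ⟨fun hlt h => ?_, affLength_mul_affTransp_lt_of w hxy⟩
  have h1 := affLength_mul_affTransp_lt_of (w * affTransp n x y) hxy (by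
    rw [AffinePerm.mul_apply, AffinePerm.mul_apply, affTransp_apply_left hxy,
      affTransp_apply_right hxy]
    have h2 := w.apply_ne hxy
    have h3 : x ≠ y := fun e => hxy (by rw [e])
    omega)
  rw [mul_affTransp_mul_affTransp] at h1
  omega

theorem lt_affLength_mul_affTransp_iff (w : AffinePerm n) {x y : ℤ}
    (hxy : ¬ x ≡ y [ZMOD n]) :
    affLength w < affLength (w * affTransp n x y) ↔ (x < y ↔ w.1 x < w.1 y) := by
  have h1 := affLength_mul_affTransp_lt_iff w hxy
  have h2 := affLength_mul_affTransp_ne w hxy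
  have h3 : affLength w < affLength (w * affTransp n x y) ↔
      ¬ affLength (w * affTransp n x y) < affLength w := by
    have : affLength (w * affTransp n x y) ≠ affLength w := fun e => h2 (by rw [e])
    omega
  rw [h3, h1, not_not]

theorem affLength_simpleRefl (i : ZMod n) : affLength (simpleRefl n i) = 1 := by
  have h1 : affLength (simpleRefl n i) ≤ 1 := by
    simpa [wordProd] using affLength_wordProd_le [i]
  obtain ⟨z, rfl⟩ := ZMod.intCast_surjective i
  have h2 := affLength_mul_affTransp_ne (1 : AffinePerm n) (not_modEq_add_one z)
  rw [one_mul, ← simpleRefl_intCast, affLength_one] at h2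
  omega

/-- Removing a letter from a reduced word so that it remains reduced goes down a cover. -/
theorem removesOne_iff {g u : AffinePerm n} : RemovesOne g u ↔ BruhatCovers u g := by
  constructor
  · rintro ⟨a, p, hp, ha, hb⟩
    rw [isReducedWordOf_iff] at ha hb
    have hlen := List.length_eraseIdx_of_lt hp
    refine ⟨?_, by omega⟩
    rw [← ha.1, ← hb.1]
    clear ha hb hlen
    induction a generalizing p with
    | nil => simp at hp
    | cons i a ih =>
      cases p with
      | zero =>
        obtain ⟨z, rfl⟩ := ZMod.intCast_surjective i
        -- The deleted letter `t_{z,z+1}`, moved to the right end through the suffix, exchanges the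
        -- preimages of `z` and `z + 1`.
        refine ⟨((wordProd a)⁻¹).1 z, ((wordProd a)⁻¹).1 (z + 1), ?_, ?_⟩
        · rw [AffinePerm.apply_modEq_iff]
          exact not_modEq_add_one z
        · rw [List.eraseIdx_cons_zero, mul_affTransp, AffinePerm.apply_inv_self,
            AffinePerm.apply_inv_self, wordProd_cons, simpleRefl_intCast]
      | succ p =>
        obtain ⟨x, y, hxy, e⟩ := ih p (by simpa using hp)
        exact ⟨x, y, hxy, by
          rw [List.eraseIdx_cons_succ, wordProd_cons, wordProd_cons, e, mul_assoc]⟩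
  · rintro ⟨⟨x, y, hxy, e⟩, hlen⟩
    obtain ⟨a, ha, hal⟩ := exists_wordProd_eq_length g
    have e' : u = g * affTransp n x y := by rw [e, mul_affTransp_mul_affTransp]
    have hlt : affLength (g * affTransp n x y) < affLength g := by rw [← e']; omega
    rw [affLength_mul_affTransp_lt_iff g hxy, ← ha] at hlt
    obtain ⟨p, hp, he⟩ := exists_wordProd_eraseIdx a hxy hlt
    rw [ha, ← e'] at he
    refine ⟨a, p, hp, isReducedWordOf_iff.mpr ⟨ha, hal⟩, isReducedWordOf_iff.mpr ⟨he, ?_⟩⟩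
    rw [List.length_eraseIdx_of_lt hp]
    omega

end Length

/-! ### Wires through a list of affine permutations -/

section Wires

variable {n : ℕ}

/-- The product of the factors to the right of position `k`. -/
def rightProd (L : List (AffinePerm n)) (k : ℕ) : AffinePerm n := (L.drop (k + 1)).prod

/-- The `k`-th factor changes the relative order of the wires `r` and `s`. -/
def Flips (L : List (AffinePerm n)) (r s : ℤ) (k : ℕ) : Prop :=
  ¬ ((rightProd L k).1 r < (rightProd L k).1 s ↔
    (L.getD k 1).1 ((rightProd L k).1 r) < (L.getD k 1).1 ((rightProd L k).1 s))

/-- The number of factors that change the relative order of the wires `r` and `s`. -/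
def numFlips (r s : ℤ) : List (AffinePerm n) → ℕ
  | [] => 0
  | g :: L => numFlips r s L +
      if L.prod.1 r < L.prod.1 s ↔ g.1 (L.prod.1 r) < g.1 (L.prod.1 s) then 0 else 1

theorem not_flips_nil (r s : ℤ) (k : ℕ) : ¬ Flips ([] : List (AffinePerm n)) r s k := by
  simp [Flips]

theorem flips_cons_zero (g : AffinePerm n) (L : List (AffinePerm n)) (r s : ℤ) :
    Flips (g :: L) r s 0 ↔
      ¬ (L.prod.1 r < L.prod.1 s ↔ g.1 (L.prod.1 r) < g.1 (L.prod.1 s)) := Iff.rfl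

theorem flips_cons_succ (g : AffinePerm n) (L : List (AffinePerm n)) (r s : ℤ) (k : ℕ) :
    Flips (g :: L) r s (k + 1) ↔ Flips L r s k := Iff.rfl

theorem one_le_numFlips {r s : ℤ} {L : List (AffinePerm n)} {i : ℕ} (hi : Flips L r s i) :
    1 ≤ numFlips r s L := by
  induction L generalizing i with
  | nil => exact absurd hi (not_flips_nil r s i)
  | cons g L ih =>
    cases i with
    | zero => rw [numFlips, if_neg ((flips_cons_zero ..).mp hi)]; omega
    | succ i => exact (ih ((flips_cons_succ ..).mp hi)).trans (by simp [numFlips])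

theorem two_le_numFlips {r s : ℤ} {L : List (AffinePerm n)} {i j : ℕ} (hij : i < j)
    (hi : Flips L r s i) (hj : Flips L r s j) : 2 ≤ numFlips r s L := by
  induction L generalizing i j with
  | nil => exact absurd hi (not_flips_nil r s i)
  | cons g L ih =>
    obtain ⟨j, rfl⟩ : ∃ j', j = j' + 1 := ⟨j - 1, by omega⟩
    rw [flips_cons_succ] at hj
    cases i with
    | zero =>
      rw [numFlips, if_neg ((flips_cons_zero ..).mp hi)]
      have := one_le_numFlips hj
      omega
    | succ i =>
      exact (ih (by omega) ((flips_cons_succ ..).mp hi) hj).trans (by simp [numFlips])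

theorem three_le_numFlips {r s : ℤ} {L : List (AffinePerm n)} {i j k : ℕ} (hij : i < j)
    (hjk : j < k) (hi : Flips L r s i) (hj : Flips L r s j) (hk : Flips L r s k) :
    3 ≤ numFlips r s L := by
  induction L generalizing i j k with
  | nil => exact absurd hi (not_flips_nil r s i)
  | cons g L ih =>
    obtain ⟨j, rfl⟩ : ∃ j', j = j' + 1 := ⟨j - 1, by omega⟩
    obtain ⟨k, rfl⟩ : ∃ k', k = k' + 1 := ⟨k - 1, by omega⟩
    rw [flips_cons_succ] at hj hk
    cases i with
    | zero =>
      rw [numFlips, if_neg ((flips_cons_zero ..).mp hi)]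
      have := two_le_numFlips (by omega) hj hk
      omega
    | succ i =>
      exact (ih (by omega) (by omega) ((flips_cons_succ ..).mp hi) hj hk).trans
        (by simp [numFlips])

/-- If two wires are in opposite orders at two places, some factor in between flips them. -/
theorem exists_flip (L : List (AffinePerm n)) (i : ℕ) {r s : ℤ} (hrs : r ≠ s)
    (h : (L.drop i).prod.1 r < (L.drop i).prod.1 s) (h' : L.prod.1 s < L.prod.1 r) :
    ∃ j < i, (rightProd L j).1 r < (rightProd L j).1 s ∧
      (L.getD j 1).1 ((rightProd L j).1 s) < (L.getD j 1).1 ((rightProd L j).1 r) := by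
  induction L generalizing i with
  | nil => simp only [List.drop_nil] at h; omega
  | cons g L ih =>
    cases i with
    | zero => rw [List.drop_zero] at h; omega
    | succ i =>
      rw [List.drop_succ_cons] at h
      rcases lt_trichotomy (L.prod.1 r) (L.prod.1 s) with h1 | h1 | h1
      · rw [List.prod_cons] at h'
        exact ⟨0, by omega, h1, h'⟩
      · exact absurd (L.prod.1.injective h1) hrs
      · obtain ⟨j, hj, hj'⟩ := ih i h h1
        exact ⟨j + 1, by omega, hj'⟩

/-- At the right end the wires are in the order `r < s`, so `exists_flip` for the factors right of
`i` finds the crossing; the index shifts by `i + 1`. -/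
theorem exists_flip_right (L : List (AffinePerm n)) (i : ℕ) {r s : ℤ} (hrs : r < s)
    (h : (rightProd L i).1 s < (rightProd L i).1 r) :
    ∃ j, i < j ∧ (rightProd L j).1 r < (rightProd L j).1 s ∧
      (L.getD j 1).1 ((rightProd L j).1 s) < (L.getD j 1).1 ((rightProd L j).1 r) := by
  obtain ⟨j, -, hj⟩ := exists_flip (L.drop (i + 1)) (L.drop (i + 1)).length hrs.ne
    (by rwa [List.drop_length]) h
  refine ⟨i + 1 + j, by omega, ?_⟩
  simpa [rightProd, List.getD_eq_getElem?_getD, add_assoc] using hj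

theorem prod_eq_mul_rightProd (L : List (AffinePerm n)) {k : ℕ} (hk : k < L.length) :
    L.prod = (L.take k).prod * L.getD k 1 * rightProd L k := by
  induction L generalizing k with
  | nil => simp at hk
  | cons g L ih =>
    cases k with
    | zero => simp [rightProd]
    | succ k =>
      rw [List.prod_cons, ih (by simpa using hk)]
      simp [rightProd, mul_assoc]

theorem prod_set_eq_mul_rightProd (L : List (AffinePerm n)) {k : ℕ} (hk : k < L.length)
    (u : AffinePerm n) : (L.set k u).prod = (L.take k).prod * u * rightProd L k := by
  induction L generalizing k with
  | nil => simp at hk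
  | cons g L ih =>
    cases k with
    | zero => simp [rightProd]
    | succ k =>
      rw [List.set_cons_succ, List.prod_cons, ih (by simpa using hk)]
      simp [rightProd, mul_assoc]

theorem sum_affLength_set (L : List (AffinePerm n)) {k : ℕ} (hk : k < L.length)
    (u : AffinePerm n) : ((L.set k u).map affLength).sum + affLength (L.getD k 1) =
      (L.map affLength).sum + affLength u := by
  induction L generalizing k with
  | nil => simp at hk
  | cons g L ih =>
    cases k with
    | zero => simp; omega
    | succ k =>
      have := ih (k := k) (by simpa using hk)
      simp only [List.set_cons_succ, List.map_cons, List.sum_cons, List.getD_cons_succ]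
      omega

theorem rightProd_set (L : List (AffinePerm n)) (k : ℕ) (u : AffinePerm n) :
    rightProd (L.set k u) k = rightProd L k := by
  rw [rightProd, List.drop_set_of_lt (by omega), rightProd]

theorem getD_set_self (L : List (AffinePerm n)) {k : ℕ} (hk : k < L.length)
    (u : AffinePerm n) : (L.set k u).getD k 1 = u := by
  simp [List.getD_eq_getElem?_getD, hk]

theorem drop_prod_eq (L : List (AffinePerm n)) {k : ℕ} (hk : k < L.length) :
    (L.drop k).prod = L.getD k 1 * rightProd L k := by
  rw [List.drop_eq_getElem_cons hk, List.prod_cons, rightProd, List.getD_eq_getElem _ _ hk]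

/-! ### Crossings, marks and covers -/

variable [Fact (1 < n)]

/-- Flipping factors can be shortened, at the cost of a reflection at the right end. -/
theorem affLength_prod_mul_pow_le (L : List (AffinePerm n)) {r s : ℤ}
    (hrs : ¬ r ≡ s [ZMOD n]) {K : ℕ} (hK : K ≤ numFlips r s L) :
    affLength (L.prod * affTransp n r s ^ K) + K ≤ (L.map affLength).sum := by
  induction L generalizing K with
  | nil =>
    obtain rfl : K = 0 := by simpa [numFlips] using hK
    simp [affLength_one]
  | cons g L ih =>
    rw [List.prod_cons, List.map_cons, List.sum_cons]
    by_cases h : K ≤ numFlips r s L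
    · have h1 := ih h
      have h2 := affLength_mul_le g (L.prod * affTransp n r s ^ K)
      rw [← mul_assoc] at h2
      omega
    · rw [numFlips] at hK
      split_ifs at hK with hf
      · omega
      -- All crossings are used, including the one at `g`. Shortening `g` there multiplies it by the
      -- reflection in the images of `r` and `s`, which becomes one more factor `t_{r,s}` when moved
      -- to the right end.
      · obtain rfl : K = numFlips r s L + 1 := by omega
        have h1 := ih le_rfl
        have hrs' : ¬ L.prod.1 r ≡ L.prod.1 s [ZMOD n] := by
          rwa [AffinePerm.apply_modEq_iff]
        have h2 := affLength_mul_affTransp_lt_of g hrs' hf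
        have h3 := affLength_mul_le (g * affTransp n (L.prod.1 r) (L.prod.1 s))
          (L.prod * affTransp n r s ^ numFlips r s L)
        have h4 : g * affTransp n (L.prod.1 r) (L.prod.1 s) *
            (L.prod * affTransp n r s ^ numFlips r s L) =
            g * L.prod * affTransp n r s ^ (numFlips r s L + 1) := by
          rw [pow_succ', ← mul_assoc, mul_assoc g, ← mul_affTransp]
          simp only [mul_assoc]
        rw [h4] at h3
        omega

/-- The marked factor at `k` exchanges the wires `r` and `s`, of which `r` comes in lower; without
this exchange the product is `v`. -/
structure WirePair (v : AffinePerm n) (L : List (AffinePerm n)) (k : ℕ) (r s : ℤ) : Prop where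
  not_modEq : ¬ r ≡ s [ZMOD n]
  lt : (rightProd L k).1 r < (rightProd L k).1 s
  gt : (L.getD k 1).1 ((rightProd L k).1 s) < (L.getD k 1).1 ((rightProd L k).1 r)
  prod_eq : L.prod * affTransp n r s = v

/-- Replacing the `k`-th factor by an element that it covers makes the product `v`. -/
def IsMark (v : AffinePerm n) (L : List (AffinePerm n)) (k : ℕ) : Prop :=
  ∃ u, BruhatCovers u (L.getD k 1) ∧ (L.set k u).prod = v

variable {v : AffinePerm n} {L : List (AffinePerm n)}

-- The default factor `1` beyond the end of the list crosses no wires.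
omit [Fact (1 < n)] in
theorem WirePair.lt_length {k : ℕ} {r s : ℤ} (h : WirePair v L k r s) : k < L.length := by
  by_contra hk
  have h1 := h.gt
  rw [List.getD_eq_default _ _ (by omega)] at h1
  exact absurd h.lt (not_lt.mpr (le_of_lt h1))

omit [Fact (1 < n)] in
theorem BruhatCovers.ne_one {u g : AffinePerm n} (h : BruhatCovers u g) : g ≠ 1 := by
  rintro rfl
  have := h.2
  rw [affLength_one] at this
  omega

omit [Fact (1 < n)] in
theorem IsMark.lt_length {k : ℕ} (h : IsMark v L k) : k < L.length := by
  by_contra hk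
  obtain ⟨u, hu, -⟩ := h
  exact hu.ne_one (List.getD_eq_default _ _ (by omega))

/-- The reflection removed from the marked factor acts on positions at its right side; pulling these
back through the factors to the right gives the wires. As the factor goes down in length, it
reverses their order. -/
theorem IsMark.exists_wirePair {k : ℕ} (h : IsMark v L k) : ∃ r s, WirePair v L k r s := by
  have hk := h.lt_length
  obtain ⟨u, ⟨⟨x, y, hxy, e⟩, hlen⟩, hv⟩ := h
  have e' : u = L.getD k 1 * affTransp n x y := by rw [e, mul_affTransp_mul_affTransp]
  have main : ∀ x y : ℤ, x < y → ¬ x ≡ y [ZMOD n] → u = L.getD k 1 * affTransp n x y →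
      ∃ r s, WirePair v L k r s := by
    intro x y hlt hxy e'
    have h1 : affLength (L.getD k 1 * affTransp n x y) < affLength (L.getD k 1) := by
      rw [← e']; omega
    rw [affLength_mul_affTransp_lt_iff _ hxy] at h1
    have h2 := (L.getD k 1).apply_ne hxy
    refine ⟨((rightProd L k)⁻¹).1 x, ((rightProd L k)⁻¹).1 y, ?_, ?_, ?_, ?_⟩
    · rwa [AffinePerm.apply_modEq_iff]
    · simpa only [AffinePerm.apply_inv_self] using hlt
    · simp only [AffinePerm.apply_inv_self]
      omega
    · rw [prod_eq_mul_rightProd L hk, mul_assoc, mul_affTransp, AffinePerm.apply_inv_self,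
        AffinePerm.apply_inv_self, ← hv, prod_set_eq_mul_rightProd L hk, e']
      simp only [mul_assoc]
  rcases lt_trichotomy x y with hlt | rfl | hlt
  · exact main x y hlt hxy e'
  · exact absurd rfl hxy
  · exact main y x hlt (fun h => hxy h.symm) (by rw [e', affTransp_comm])

omit [Fact (1 < n)] in
theorem WirePair.set_prod {k : ℕ} {r s : ℤ} (h : WirePair v L k r s) :
    (L.set k (L.getD k 1 * affTransp n ((rightProd L k).1 r) ((rightProd L k).1 s))).prod
      = v := by
  rw [prod_set_eq_mul_rightProd L h.lt_length, ← h.prod_eq,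
    prod_eq_mul_rightProd L h.lt_length, mul_assoc _ (rightProd L k), mul_affTransp (rightProd L k)]
  simp only [mul_assoc]

/-- Undoing the crossing shortens the factor, but by only one: the remaining lengths must still add
up to at least `ℓ(v)`. -/
theorem WirePair.isMark {k : ℕ} {r s : ℤ} (h : WirePair v L k r s)
    (hsum : (L.map affLength).sum = affLength v + 1) : IsMark v L k := by
  have hrs : ¬ (rightProd L k).1 r ≡ (rightProd L k).1 s [ZMOD n] := by
    rw [AffinePerm.apply_modEq_iff]; exact h.not_modEq
  refine ⟨_, ⟨⟨_, _, hrs, (mul_affTransp_mul_affTransp ..).symm⟩, ?_⟩, h.set_prod⟩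
  have h1 := affLength_mul_affTransp_lt_of (L.getD k 1) hrs
    (fun h' => absurd (h'.mp h.lt) (not_lt.mpr h.gt.le))
  have h2 := sum_affLength_set L h.lt_length
    (L.getD k 1 * affTransp n ((rightProd L k).1 r) ((rightProd L k).1 s))
  have h3 := affLength_prod_le (L.set k
    (L.getD k 1 * affTransp n ((rightProd L k).1 r) ((rightProd L k).1 s)))
  rw [h.set_prod] at h3
  omega

/-- The right side involves the pair only through its reflection, so wire pairs found at different
marks of one list can be compared. -/
theorem flips_iff (L : List (AffinePerm n)) (k : ℕ) {r s : ℤ} (h : ¬ r ≡ s [ZMOD n]) :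
    Flips L r s k ↔ affLength (L.getD k 1 * (rightProd L k * affTransp n r s *
      (rightProd L k)⁻¹)) < affLength (L.getD k 1) := by
  rw [mul_affTransp, mul_inv_cancel_right, affLength_mul_affTransp_lt_iff, Flips]
  rwa [AffinePerm.apply_modEq_iff]

theorem WirePair.flips {k : ℕ} {r s r' s' : ℤ} (h : WirePair v L k r s)
    (h' : ¬ r' ≡ s' [ZMOD n]) (hv : L.prod * affTransp n r' s' = v) : Flips L r' s' k := by
  have e : affTransp n r' s' = affTransp n r s := mul_left_cancel (hv.trans h.prod_eq.symm)
  rw [flips_iff L k h', e, ← flips_iff L k h.not_modEq]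
  exact fun h'' => absurd (h''.mp h.lt) (not_lt.mpr h.gt.le)

/-- Two marks are two crossings of the same pair. Removing both leaves the product unchanged, since
reflections are involutions, yet makes it at least two shorter than the sum of the lengths. -/
theorem IsMark.eq_of_additive {i j : ℕ} (hi : IsMark v L i) (hj : IsMark v L j)
    (hadd : (L.map affLength).sum = affLength L.prod) : i = j := by
  obtain ⟨r, s, h⟩ := hi.exists_wirePair
  obtain ⟨r', s', h'⟩ := hj.exists_wirePair
  have key : ∀ {a b : ℕ}, a < b → Flips L r s a → Flips L r s b → False := by
    intro a b hab ha hb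
    have h1 := affLength_prod_mul_pow_le L h.not_modEq (two_le_numFlips hab ha hb)
    rw [pow_two, affTransp_mul_self, mul_one] at h1
    omega
  have fi := h.flips h.not_modEq h.prod_eq
  have fj := h'.flips h.not_modEq h.prod_eq
  rcases lt_trichotomy i j with hlt | rfl | hlt
  · exact (key hlt fi fj).elim
  · rfl
  · exact (key hlt fj fi).elim

/-- Removing three crossings has the same effect on the product as removing one, namely to give `v`;
this would yield `ℓ(v) + 3 ≤ ℓ(v) + 1`. -/
theorem IsMark.eq_or_eq_or_eq {i j k : ℕ} (hi : IsMark v L i) (hj : IsMark v L j)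
    (hk : IsMark v L k) (hsum : (L.map affLength).sum = affLength v + 1) :
    i = j ∨ j = k ∨ i = k := by
  obtain ⟨r, s, h⟩ := hi.exists_wirePair
  obtain ⟨_, _, h'⟩ := hj.exists_wirePair
  obtain ⟨_, _, h''⟩ := hk.exists_wirePair
  have key : ∀ {a b c : ℕ}, a < b → b < c → Flips L r s a → Flips L r s b →
      Flips L r s c → False := by
    intro a b c hab hbc ha hb hc
    have h1 := affLength_prod_mul_pow_le L h.not_modEq (three_le_numFlips hab hbc ha hb hc)
    rw [pow_succ, pow_two, affTransp_mul_self, one_mul, h.prod_eq] at h1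
    omega
  have fi := h.flips h.not_modEq h.prod_eq
  have fj := h'.flips h.not_modEq h.prod_eq
  have fk := h''.flips h.not_modEq h.prod_eq
  rcases lt_trichotomy i j with h1 | h1 | h1 <;> rcases lt_trichotomy j k with h2 | h2 | h2 <;>
    rcases lt_trichotomy i k with h3 | h3 | h3 <;> first | omega | skip
  · exact (key h1 h2 fi fj fk).elim
  · exact (key h3 h2 fi fk fj).elim
  · exact (key h3 h1 fk fi fj).elim
  · exact (key h1 h3 fj fi fk).elim
  · exact (key h2 h3 fj fk fi).elim
  · exact (key h2 h1 fk fj fi).elim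

/-- When the factors are not length additive, the exchanged wires meet once more. -/
theorem WirePair.exists_ne {i : ℕ} {r s : ℤ} (h : WirePair v L i s r)
    (hsum : (L.map affLength).sum = affLength v + 1)
    (hadd : affLength L.prod ≠ affLength v + 1) : ∃ j ≠ i, WirePair v L j r s := by
  -- The length of the product is at most `ℓ(v) + 1`, is not equal to it, and has the parity
  -- opposite to `ℓ(v)`.
  have hlt : affLength L.prod < affLength v := by
    have h1 := affLength_prod_le L
    have h2 := affLength_mul_affTransp_ne L.prod h.not_modEq
    rw [h.prod_eq] at h2
    omega
  have hrs : ¬ r ≡ s [ZMOD n] := fun h' => h.not_modEq h'.symm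
  have hne : r ≠ s := fun e => hrs (by rw [e])
  have hv : L.prod * affTransp n r s = v := by rw [affTransp_comm, h.prod_eq]
  rw [← hv, lt_affLength_mul_affTransp_iff _ hrs] at hlt
  -- The wires have the same order at both ends, while `s` enters factor `i` below `r` and leaves
  -- above it. If `r < s`, they already crossed to the right of `i`; otherwise they cross back to
  -- the left of it.
  rcases lt_or_gt_of_ne hne with hlt' | hlt'
  · obtain ⟨j, hj, h1, h2⟩ := exists_flip_right L i hlt' h.lt
    exact ⟨j, by omega, hrs, h1, h2, hv⟩
  · have h1 : (L.drop i).prod.1 r < (L.drop i).prod.1 s := by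
      rw [drop_prod_eq L h.lt_length]
      exact h.gt
    have h2 := L.prod.apply_ne hrs
    obtain ⟨j, hj, h3, h4⟩ := exists_flip L i hne h1 (by omega)
    exact ⟨j, by omega, hrs, h3, h4, hv⟩

/-- Wires that enter factor `i` out of their initial order have crossed before, and additivity
forbids a second crossing. -/
theorem WirePair.lt_of_additive {i : ℕ} {r s : ℤ} (h : WirePair v L i r s)
    (hadd : (L.map affLength).sum = affLength L.prod) : r < s := by
  by_contra hlt
  have hne : r ≠ s := fun e => h.not_modEq (by rw [e])
  have hsr : ¬ s ≡ r [ZMOD n] := fun h' => h.not_modEq h'.symm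
  obtain ⟨j, hj, h1, h2⟩ := exists_flip_right L i (show s < r by omega) h.lt
  have h3 : WirePair v L j s r := ⟨hsr, h1, h2, by rw [affTransp_comm, h.prod_eq]⟩
  have h4 := affLength_prod_mul_pow_le L h.not_modEq (two_le_numFlips hj
    (h.flips h.not_modEq h.prod_eq) (h3.flips h.not_modEq h.prod_eq))
  rw [pow_two, affTransp_mul_self, mul_one] at h4
  omega

/-- The lower wire at the mark names the right covers. In `WirePair.mem_leftCovers`, the upper wire
names the left covers. -/
theorem WirePair.mem_rightCovers {i : ℕ} {r s : ℤ} (h : WirePair v L i r s)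
    (hsum : (L.map affLength).sum = affLength v + 1)
    (hadd : affLength L.prod = affLength v + 1) : L.prod ∈ rightCovers r v := by
  have e := mul_affTransp_eq_iff.mp h.prod_eq
  exact ⟨⟨⟨r, s, h.not_modEq, e⟩, hadd⟩, s, h.lt_of_additive (by omega), h.not_modEq, e⟩

theorem WirePair.mem_leftCovers {i : ℕ} {r s : ℤ} (h : WirePair v L i s r)
    (hsum : (L.map affLength).sum = affLength v + 1)
    (hadd : affLength L.prod = affLength v + 1) : L.prod ∈ leftCovers r v := by
  have e := mul_affTransp_eq_iff.mp h.prod_eq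
  exact ⟨⟨⟨s, r, h.not_modEq, e⟩, hadd⟩, s, h.lt_of_additive (by omega), h.not_modEq, e⟩

theorem exists_wirePair_of_cover {r s : ℤ} (hlt : r < s) (hrs : ¬ r ≡ s [ZMOD n])
    (e : L.prod = v * affTransp n r s) (hlen : affLength L.prod = affLength v + 1) :
    ∃ i, WirePair v L i r s := by
  have hv := mul_affTransp_eq_iff.mpr e
  have h1 : affLength (L.prod * affTransp n r s) < affLength L.prod := by rw [hv]; omega
  rw [affLength_mul_affTransp_lt_iff _ hrs] at h1
  have h2 := L.prod.apply_ne hrs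
  obtain ⟨i, -, h3, h4⟩ := exists_flip L L.length hlt.ne
    (by rwa [List.drop_length]) (by omega)
  exact ⟨i, hrs, h3, h4, hv⟩

theorem exists_wirePair_of_mem_rightCovers {r : ℤ} (h : L.prod ∈ rightCovers r v) :
    ∃ i s, WirePair v L i r s := by
  obtain ⟨⟨-, hlen⟩, s, hlt, hrs, e⟩ := h
  obtain ⟨i, hi⟩ := exists_wirePair_of_cover hlt hrs e hlen
  exact ⟨i, s, hi⟩

theorem exists_wirePair_of_mem_leftCovers {r : ℤ} (h : L.prod ∈ leftCovers r v) :
    ∃ i s, WirePair v L i s r := by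
  obtain ⟨⟨-, hlen⟩, s, hlt, hrs, e⟩ := h
  obtain ⟨i, hi⟩ := exists_wirePair_of_cover hlt hrs e hlen
  exact ⟨i, s, hi⟩

-- The cover determines its reflection, hence its increasing pair of indices up to a common shift.
-- This and its left analogue let the preserved wire be recovered modulo `n` from a product.
omit [Fact (1 < n)] in
theorem modEq_of_mem_rightCovers {w : AffinePerm n} {r r' : ℤ} (h : w ∈ rightCovers r v)
    (h' : w ∈ rightCovers r' v) : r ≡ r' [ZMOD n] := by
  obtain ⟨-, s, hlt, hrs, e⟩ := h
  obtain ⟨-, s', hlt', hrs', e'⟩ := h'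
  obtain ⟨k, hk, -⟩ := (affTransp_eq_iff hrs hrs' hlt hlt').mp (mul_left_cancel (e.symm.trans e'))
  exact Int.modEq_iff_exists_add_mul.mpr ⟨k, hk⟩

omit [Fact (1 < n)] in
theorem modEq_of_mem_leftCovers {w : AffinePerm n} {r r' : ℤ} (h : w ∈ leftCovers r v)
    (h' : w ∈ leftCovers r' v) : r ≡ r' [ZMOD n] := by
  obtain ⟨-, s, hlt, hrs, e⟩ := h
  obtain ⟨-, s', hlt', hrs', e'⟩ := h'
  obtain ⟨k, -, hk⟩ := (affTransp_eq_iff hrs hrs' hlt hlt').mp (mul_left_cancel (e.symm.trans e'))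
  exact Int.modEq_iff_exists_add_mul.mpr ⟨k, hk⟩

omit [Fact (1 < n)] in
theorem rightCovers_congr {r r' : ℤ} (h : r ≡ r' [ZMOD n]) (v : AffinePerm n) :
    rightCovers r v ⊆ rightCovers r' v := by
  obtain ⟨k, rfl⟩ := Int.modEq_iff_exists_add_mul.mp h
  rintro w ⟨hw, s, hlt, hrs, e⟩
  exact ⟨hw, s + k * n, by omega, by rwa [add_mul_modEq_add_mul], by rw [affTransp_add_mul, e]⟩

omit [Fact (1 < n)] in
/-- If `g` is obtained from `u` by exchanging `c < e` and `g'` by exchanging `d < c`, replacing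
`g` by `g'` turns the lower exchanged wire into the upper one. -/
theorem WirePair.set {k : ℕ} {r s c d e : ℤ} {u g' : AffinePerm n} (h : WirePair v L k r s)
    (hu : (L.set k u).prod = v) (hce : c < e) (hce' : ¬ c ≡ e [ZMOD n])
    (hg : L.getD k 1 = u * affTransp n c e) (hdc : d < c) (hdc' : ¬ d ≡ c [ZMOD n])
    (hudc : u.1 d < u.1 c) (hg' : g' = u * affTransp n d c) :
    ∃ q, WirePair v (L.set k g') k q r := by
  have hk := h.lt_length
  -- With the other factors fixed, the product `v` leaves only one choice for the lowered factor, so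
  -- `u` undoes precisely this crossing.
  have e1 : u = L.getD k 1 * affTransp n ((rightProd L k).1 r) ((rightProd L k).1 s) := by
    have e1 := hu.trans h.set_prod.symm
    rw [prod_set_eq_mul_rightProd L hk, prod_set_eq_mul_rightProd L hk] at e1
    exact mul_left_cancel (mul_right_cancel e1)
  have e2 : u * affTransp n c e = u * affTransp n ((rightProd L k).1 r) ((rightProd L k).1 s) := by
    rw [← hg]
    exact (mul_affTransp_eq_iff.mp e1.symm)
  -- Both pairs are increasing, so the wires `r` and `s` enter at `c + l n` and `e + l n` for one
  -- `l`. The new partner `q` is the wire entering at `d + l n`.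
  obtain ⟨l, hr, -⟩ := (affTransp_eq_iff hce' (by
    rw [AffinePerm.apply_modEq_iff]; exact h.not_modEq) hce h.lt).mp (mul_left_cancel e2)
  have hq : (rightProd L k).1 (((rightProd L k)⁻¹).1 (d + l * n)) = d + l * n :=
    AffinePerm.apply_inv_self _ _
  refine ⟨((rightProd L k)⁻¹).1 (d + l * n), ?_, ?_, ?_, ?_⟩
  · rwa [← (rightProd L k).apply_modEq_iff, hq, hr, add_mul_modEq_add_mul]
  · rw [rightProd_set, hq, hr]
    omega
  · rw [rightProd_set, getD_set_self L hk, hq, hr, AffinePerm.apply_add_mul,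
      AffinePerm.apply_add_mul, hg', AffinePerm.mul_apply, AffinePerm.mul_apply,
      affTransp_apply_left hdc', affTransp_apply_right hdc']
    omega
  · rw [prod_set_eq_mul_rightProd L hk, mul_assoc, mul_affTransp, hq, hr, affTransp_add_mul, hg',
      ← hu, prod_set_eq_mul_rightProd L hk, ← mul_assoc, ← mul_assoc (L.take k).prod u,
      mul_affTransp_mul_affTransp]

end Wires

/-! ### Cyclically decreasing permutations -/

section CycDec

variable {n : ℕ}

/-- `f` maps `x` to `x - 1` if `x - 1` lies in `A`, and otherwise to the first `y ≥ x` outside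
`A`. -/
structure CycAt (A : Finset (ZMod n)) (f : ℤ → ℤ) (x : ℤ) : Prop where
  of_mem : ((x - 1 : ℤ) : ZMod n) ∈ A → f x = x - 1
  le : ((x - 1 : ℤ) : ZMod n) ∉ A → x ≤ f x
  notMem : ((x - 1 : ℤ) : ZMod n) ∉ A → ((f x : ℤ) : ZMod n) ∉ A
  mem : ((x - 1 : ℤ) : ZMod n) ∉ A → ∀ z, x ≤ z → z < f x → (z : ZMod n) ∈ A

theorem CycAt.eq {A : Finset (ZMod n)} {f g : ℤ → ℤ} {x : ℤ} (hf : CycAt A f x)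
    (hg : CycAt A g x) : f x = g x := by
  by_cases h : ((x - 1 : ℤ) : ZMod n) ∈ A
  · rw [hf.of_mem h, hg.of_mem h]
  · rcases lt_trichotomy (f x) (g x) with h1 | h1 | h1
    · exact absurd (hg.mem h _ (hf.le h) h1) (hf.notMem h)
    · exact h1
    · exact absurd (hf.mem h _ (hg.le h) h1) (hg.notMem h)

theorem intCast_add_mul (x k : ℤ) : ((x + k * n : ℤ) : ZMod n) = x := by simp

theorem CycAt.add_mul {A : Finset (ZMod n)} {w : AffinePerm n} {x : ℤ} (h : CycAt A w.1 x)
    (k : ℤ) : CycAt A w.1 (x + k * n) := by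
  have e : ((x + k * n - 1 : ℤ) : ZMod n) = ((x - 1 : ℤ) : ZMod n) := by push_cast; simp
  constructor
  · intro h1
    rw [w.apply_add_mul, h.of_mem (e ▸ h1)]; ring
  · intro h1
    have := h.le (e ▸ h1)
    rw [w.apply_add_mul]; omega
  · intro h1
    rw [w.apply_add_mul, intCast_add_mul]
    exact h.notMem (e ▸ h1)
  · intro h1 z hz1 hz2
    rw [w.apply_add_mul] at hz2
    have := h.mem (e ▸ h1) (z - k * n) (by omega) (by omega)
    rwa [← intCast_add_mul (n := n) _ k, sub_add_cancel] at this

/-- The affine permutation `w` is given by the formula for `w(A)`. -/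
def IsCycFun (A : Finset (ZMod n)) (w : AffinePerm n) : Prop := ∀ x, CycAt A w.1 x

theorem IsCycFun.eq {A : Finset (ZMod n)} {v w : AffinePerm n} (hv : IsCycFun A v)
    (hw : IsCycFun A w) : v = w :=
  AffinePerm.ext_apply fun x => (hv x).eq (hw x)

/-- Recovers `A` from the values of `w`, so that the set of letters is an invariant of the element
and not just of a word. -/
theorem IsCycFun.mem_iff {A : Finset (ZMod n)} {w : AffinePerm n} (h : IsCycFun A w) (x : ℤ) :
    (x : ZMod n) ∈ A ↔ w.1 (x + 1) = x := by
  have h1 := h (x + 1)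
  have e : ((x + 1 - 1 : ℤ) : ZMod n) = x := by simp
  constructor
  · intro hx
    rw [h1.of_mem (e.symm ▸ hx)]; ring
  · intro hx
    by_contra hA
    have := h1.le (e.symm ▸ hA)
    omega

theorem IsCycFun.eq_set {A B : Finset (ZMod n)} {w : AffinePerm n} (hA : IsCycFun A w)
    (hB : IsCycFun B w) : A = B := by
  ext i
  obtain ⟨x, rfl⟩ := ZMod.intCast_surjective i
  rw [hA.mem_iff, hB.mem_iff]

theorem isCycFun_empty : IsCycFun (∅ : Finset (ZMod n)) 1 := fun x =>
  ⟨by simp, fun _ => le_refl x, by simp, fun _ z h1 h2 => absurd (lt_of_le_of_lt h1 h2)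
    (lt_irrefl x)⟩

/-- A run of `n` or more letters would wrap around the circle and contain the letter `i - j - 1` at
which it stops. -/
theorem sub_lt_of_run {A : Finset (ZMod n)} {i : ℤ} {j : ℕ}
    (hrun : ∀ k : ℕ, k ≤ j → ((i - k : ℤ) : ZMod n) ∈ A)
    (hend : ((i - j - 1 : ℤ) : ZMod n) ∉ A) (hn : 0 < n) : j + 1 < n := by
  by_contra hlt
  have h := hrun (j + 1 - n) (by omega)
  have e : (i - ((j + 1 - n : ℕ) : ℤ) : ℤ) = i - j - 1 + 1 * n := by
    push_cast [Nat.cast_sub (show n ≤ j + 1 by omega)]; ring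
  rw [e, intCast_add_mul] at h
  exact hend h

variable [Fact (1 < n)]

theorem run_mem_erase {A : Finset (ZMod n)} {i : ℤ} {j : ℕ}
    (hrun : ∀ k : ℕ, k ≤ j → ((i - k : ℤ) : ZMod n) ∈ A)
    (hend : ((i - j - 1 : ℤ) : ZMod n) ∉ A) {z : ℤ} (h1 : i - j ≤ z) (h2 : z < i) :
    (z : ZMod n) ∈ A.erase (i : ZMod n) := by
  have hn : 1 < n := Fact.out
  have hj := sub_lt_of_run hrun hend (by omega)
  obtain ⟨k, hk⟩ : ∃ k : ℕ, z = i - k := ⟨(i - z).toNat, by omega⟩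
  refine Finset.mem_erase.mpr ⟨?_, hk ▸ hrun k (by omega)⟩
  rw [Ne, ZMod.intCast_eq_intCast_iff, Int.modEq_iff_dvd]
  intro hd
  have := Int.le_of_dvd (by omega) hd
  omega

/-- Inserting `i` into a set multiplies `w(B)` by a reflection. -/
theorem IsCycFun.run {A : Finset (ZMod n)} {u : AffinePerm n} {i : ℤ} {j : ℕ}
    (hu : IsCycFun (A.erase (i : ZMod n)) u)
    (hrun : ∀ k : ℕ, k ≤ j → ((i - k : ℤ) : ZMod n) ∈ A)
    (hend : ((i - j - 1 : ℤ) : ZMod n) ∉ A) :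
    IsCycFun A (u * affTransp n (i - j) (i + 1)) ∧ ¬ i - j ≡ i + 1 [ZMOD n] ∧
      u.1 (i - j) = i ∧ i < u.1 (i + 1) := by
  have hi : (i : ZMod n) ∈ A := by simpa using hrun 0 (by omega)
  have hne : ¬ i - j ≡ i + 1 [ZMOD n] := by
    intro h
    have h1 := h.sub_right 1
    rw [add_sub_cancel_right, ← ZMod.intCast_eq_intCast_iff] at h1
    exact hend (h1 ▸ hi)
  have hend' : ((i - j - 1 : ℤ) : ZMod n) ∉ A.erase (i : ZMod n) :=
    fun h => hend (Finset.mem_of_mem_erase h)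
  have hB : ∀ {z : ℤ}, i - j ≤ z → z < i → (z : ZMod n) ∈ A.erase (i : ZMod n) :=
    fun h1 h2 => run_mem_erase hrun hend h1 h2
  -- Without `i`, the first integer from `i - j` upwards outside the set is `i` itself.
  have huc : u.1 (i - j) = i := by
    have h := hu (i - j)
    rcases lt_trichotomy (u.1 (i - j)) i with h1 | h1 | h1
    · exact absurd (hB (h.le hend') h1) (h.notMem hend')
    · exact h1
    · exact absurd (h.mem hend' i (by omega) h1) (Finset.notMem_erase _ _)
  have hi' : ((i + 1 - 1 : ℤ) : ZMod n) ∉ A.erase (i : ZMod n) := by simp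
  have hui := (hu (i + 1)).le hi'
  refine ⟨fun x => ?_, hne, huc, by omega⟩
  have hmem : ∀ {z : ℤ}, ¬ z ≡ i [ZMOD n] → (z : ZMod n) ∉ A.erase (i : ZMod n) →
      (z : ZMod n) ∉ A := by
    intro z hz h h'
    exact h (Finset.mem_erase.mpr ⟨by rwa [Ne, ZMod.intCast_eq_intCast_iff], h'⟩)
  -- Only two classes change their values: `i + 1` now goes to `i`, and the run ending at `i` is
  -- joined to the one above it, so `i - j` goes to `u (i + 1)`.
  by_cases hxc : i - j ≡ x [ZMOD n]
  · obtain ⟨k, rfl⟩ := Int.modEq_iff_exists_add_mul.mp hxc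
    refine CycAt.add_mul ?_ k
    have e : (u * affTransp n (i - j) (i + 1)).1 (i - j) = u.1 (i + 1) := by
      rw [AffinePerm.mul_apply, affTransp_apply_left hne]
    constructor
    · exact fun h => absurd h hend
    · intro _
      rw [e]; omega
    · intro _
      rw [e]
      refine hmem ?_ ((hu (i + 1)).notMem hi')
      intro h
      nth_rewrite 2 [← huc] at h
      rw [u.apply_modEq_iff] at h
      exact hne h.symm
    · intro _ z hz1 hz2
      rw [e] at hz2
      rcases lt_trichotomy z i with h | h | h
      · exact Finset.mem_of_mem_erase (hB hz1 h)
      · rwa [h]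
      · exact Finset.mem_of_mem_erase ((hu (i + 1)).mem hi' z (by omega) hz2)
  · by_cases hxi : i + 1 ≡ x [ZMOD n]
    · obtain ⟨k, rfl⟩ := Int.modEq_iff_exists_add_mul.mp hxi
      refine CycAt.add_mul ?_ k
      have e : (u * affTransp n (i - j) (i + 1)).1 (i + 1) = i := by
        rw [AffinePerm.mul_apply, affTransp_apply_right hne, huc]
      have h : ((i + 1 - 1 : ℤ) : ZMod n) ∈ A := by simpa using hi
      exact ⟨fun _ => by rw [e]; ring, fun h' => absurd h h', fun h' => absurd h h',
        fun h' => absurd h h'⟩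
    · have e : (u * affTransp n (i - j) (i + 1)).1 x = u.1 x := by
        rw [AffinePerm.mul_apply, affTransp_apply_of_ne (fun h => hxc h.symm)
          (fun h => hxi h.symm)]
      have hx1 : ¬ x - 1 ≡ i [ZMOD n] := fun h => hxi (by simpa using (h.add_right 1).symm)
      have hx : ((x - 1 : ℤ) : ZMod n) ∉ A → ((x - 1 : ℤ) : ZMod n) ∉ A.erase (i : ZMod n) :=
        fun h h' => h (Finset.mem_of_mem_erase h')
      constructor
      · intro h
        rw [e]
        by_contra h'
        exact hmem hx1 (fun h'' => h' ((hu x).of_mem h'')) h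
      · intro h
        rw [e]
        exact (hu x).le (hx h)
      · intro h
        rw [e]
        refine hmem ?_ ((hu x).notMem (hx h))
        intro h'
        rw [← huc, u.apply_modEq_iff] at h'
        exact hxc h'.symm
      · intro h z hz1 hz2
        rw [e] at hz2
        exact Finset.mem_of_mem_erase ((hu x).mem (hx h) z hz1 hz2)

/-! ### Cyclically decreasing words and their sets of letters -/

omit [Fact (1 < n)] in
theorem pairwise_of_forall_idxOf {a : List (ZMod n)} (hnd : a.Nodup)
    (h : ∀ i, i ∈ a → i + 1 ∈ a → a.idxOf (i + 1) < a.idxOf i) :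
    a.Pairwise fun s t => s ≠ t ∧ t ≠ s + 1 := by
  rw [List.pairwise_iff_getElem]
  intro p q hp hq hpq
  refine ⟨fun e => ?_, fun e => ?_⟩
  · have := hnd.getElem_inj_iff.mp e
    omega
  · have := h a[p] (List.getElem_mem hp) (e ▸ List.getElem_mem hq)
    rw [← e, hnd.idxOf_getElem, hnd.idxOf_getElem] at this
    omega

/-- Induction on the last letter `x`. Neither `x` nor `x - 1` occurs before it, so its run is `x`
alone (`j = 0` in `IsCycFun.run`), and multiplying by `s_x` increases the length. -/
theorem isCycFun_wordProd {a : List (ZMod n)}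
    (ha : a.Pairwise fun s t => s ≠ t ∧ t ≠ s + 1) :
    IsCycFun a.toFinset (wordProd a) ∧ affLength (wordProd a) = a.length := by
  induction a using List.reverseRecOn with
  | nil => exact ⟨isCycFun_empty, affLength_one⟩
  | append_singleton b i ih =>
    rw [List.pairwise_append] at ha
    obtain ⟨hb, -, hbi⟩ := ha
    obtain ⟨x, rfl⟩ := ZMod.intCast_surjective i
    obtain ⟨ih1, ih2⟩ := ih hb
    have hx : (x : ZMod n) ∉ b := fun h => (hbi _ h _ (List.mem_singleton.mpr rfl)).1 rfl
    have hx1 : ((x - 1 : ℤ) : ZMod n) ∉ b := fun h =>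
      (hbi _ h _ (List.mem_singleton.mpr rfl)).2 (by push_cast; ring)
    have hset : (b ++ [(x : ZMod n)]).toFinset = insert (x : ZMod n) b.toFinset := by
      ext; simp
    have herase : (b ++ [(x : ZMod n)]).toFinset.erase (x : ZMod n) = b.toFinset := by
      rw [hset, Finset.erase_insert (by simpa using hx)]
    have hne := intCast_ne_add_one (n := n) (x - 1)
    rw [sub_add_cancel] at hne
    have hrun := IsCycFun.run (A := (b ++ [(x : ZMod n)]).toFinset) (i := x) (j := 0)
      (herase.symm ▸ ih1)
      (fun k hk => by
        obtain rfl : k = 0 := by omega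
        simp [hset])
      (by
        rw [hset, Finset.mem_insert, List.mem_toFinset]
        simp only [Nat.cast_zero, sub_zero]
        exact not_or.mpr ⟨hne, hx1⟩)
    simp only [Nat.cast_zero, sub_zero] at hrun
    obtain ⟨h1, h2, h3, h4⟩ := hrun
    rw [wordProd_append, wordProd_cons, wordProd_nil, mul_one, simpleRefl_intCast]
    refine ⟨h1, ?_⟩
    have h5 := (lt_affLength_mul_affTransp_iff (wordProd b) h2).mpr (by omega)
    have h6 := affLength_wordProd_le (b ++ [(x : ZMod n)])
    rw [wordProd_append, wordProd_cons, wordProd_nil, mul_one, simpleRefl_intCast] at h6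
    rw [List.length_append, List.length_singleton] at h6 ⊢
    omega

/-- Reducedness is automatic, and what remains is a pairwise condition, which survives the deletion
of letters. -/
theorem isCycDecWord_iff {a : List (ZMod n)} :
    IsCycDecWord a ↔ a.Pairwise fun s t => s ≠ t ∧ t ≠ s + 1 := by
  refine ⟨fun h => pairwise_of_forall_idxOf h.2.1 h.2.2, fun h => ?_⟩
  have hnd : a.Nodup := h.imp And.left
  refine ⟨isReducedWord_iff.mpr (isCycFun_wordProd h).2.symm, hnd, fun i hi hi1 => ?_⟩
  by_contra hlt
  have hle : a.idxOf i ≤ a.idxOf (i + 1) := by omega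
  have hp := List.idxOf_lt_length_iff.mpr hi
  have hq := List.idxOf_lt_length_iff.mpr hi1
  rcases hle.eq_or_lt with e | hlt'
  · have h1 := (List.idxOf_inj hi).mp e
    have h2 := ((List.idxOf_inj hi).mp e).symm
    exact absurd h2 (by simp)
  · have h1 := (List.pairwise_iff_getElem.mp h _ _ hp hq hlt').2
    simp at h1

theorem IsCycDecOn.isCycFun {A : Finset (ZMod n)} {w : AffinePerm n} (h : IsCycDecOn A w) :
    IsCycFun A w := by
  obtain ⟨a, ha, rfl, rfl⟩ := h
  exact (isCycFun_wordProd (isCycDecWord_iff.mp ha)).1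

theorem IsCycDecOn.affLength_eq {A : Finset (ZMod n)} {w : AffinePerm n}
    (h : IsCycDecOn A w) : affLength w = A.card := by
  obtain ⟨a, ha, rfl, rfl⟩ := h
  rw [(isCycFun_wordProd (isCycDecWord_iff.mp ha)).2, List.toFinset_card_of_nodup ha.2.1]

/-- If all residues occurred, the first letter `i` would have to be preceded by `i + 1`. -/
theorem IsCycDecOn.exists_notMem {A : Finset (ZMod n)} {w : AffinePerm n}
    (h : IsCycDecOn A w) : ∃ i, i ∉ A := by
  obtain ⟨a, ha, rfl, rfl⟩ := h
  by_contra! hall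
  simp only [List.mem_toFinset] at hall
  cases a with
  | nil => simpa using hall 0
  | cons i a =>
    have h1 := ha.2.2 i (hall _) (hall _)
    simp at h1

theorem isCycDec_iff {w : AffinePerm n} : IsCycDec w ↔ ∃ A, IsCycDecOn A w := by
  constructor
  · rintro ⟨a, ha, ha'⟩
    exact ⟨_, a, ha', ha.1, rfl⟩
  · rintro ⟨_, a, ha, rfl, -⟩
    exact ⟨a, isReducedWordOf_iff.mpr ⟨rfl, isReducedWord_iff.mp ha.1⟩, ha⟩

/-- A word whose letters move away downwards from a letter `c` that does not occur is cyclically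
decreasing. -/
theorem isCycDecWord_of_pairwise_val {a : List (ZMod n)} {c : ZMod n} (hc : c ∉ a)
    (h : a.Pairwise fun s t => (c - s).val < (c - t).val) : IsCycDecWord a := by
  rw [isCycDecWord_iff]
  refine h.imp_of_mem fun {s t} hs _ hlt => ⟨fun e => ?_, fun e => ?_⟩
  · rw [e] at hlt; omega
  · have h0 : c - s ≠ 0 := sub_ne_zero.mpr fun e => hc (e ▸ hs)
    have h1 : (c - t).val = (c - s).val - 1 := by
      rw [e, ← sub_sub, ZMod.val_sub, ZMod.val_one]
      rw [ZMod.val_one]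
      have := (ZMod.val_ne_zero _).mpr h0
      omega
    omega

omit [Fact (1 < n)] in
theorem pairwise_val_map_filter {ks : List ℕ} (hks : ks.Pairwise (· < ·))
    (hlt : ∀ k ∈ ks, k < n) (c : ZMod n) (A : Finset (ZMod n)) :
    ((ks.map fun k : ℕ => c - (k : ZMod n)).filter (· ∈ A)).Pairwise
      fun s t => (c - s).val < (c - t).val := by
  refine List.Pairwise.filter _ (List.pairwise_map.mpr ?_)
  refine hks.imp_of_mem fun {k l} hk hl h => ?_
  rw [sub_sub_cancel, sub_sub_cancel, ZMod.val_cast_of_lt (hlt k hk),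
    ZMod.val_cast_of_lt (hlt l hl)]
  exact h

/-- Go once around the circle downwards from the missing letter `c`, keeping the letters of `A`. -/
theorem exists_isCycDecOn {A : Finset (ZMod n)} {c : ZMod n} (hc : c ∉ A) :
    ∃ w, IsCycDecOn A w := by
  refine ⟨_, ((List.range n).map fun k : ℕ => c - (k : ZMod n)).filter (· ∈ A),
    isCycDecWord_of_pairwise_val (c := c) (fun h => hc (by simpa using (List.mem_filter.mp h).2))
      (pairwise_val_map_filter List.pairwise_lt_range (fun k hk => List.mem_range.mp hk) c A),
    rfl, ?_⟩
  ext t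
  simp only [List.mem_toFinset, List.mem_filter, List.mem_map, List.mem_range,
    decide_eq_true_eq, and_iff_right_iff_imp]
  exact fun _ => ⟨(c - t).val, ZMod.val_lt _, by simp⟩

theorem exists_run {A : Finset (ZMod n)} {c : ZMod n} (hc : c ∉ A) {i : ℤ}
    (hi : (i : ZMod n) ∈ A) : ∃ j : ℕ, (∀ k : ℕ, k ≤ j → ((i - k : ℤ) : ZMod n) ∈ A) ∧
      ((i - j - 1 : ℤ) : ZMod n) ∉ A := by
  classical
  have hex : ∃ k : ℕ, ((i - k : ℤ) : ZMod n) ∉ A :=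
    ⟨((i : ZMod n) - c).val, by simpa using hc⟩
  have h0 : Nat.find hex ≠ 0 := by
    intro h
    have := Nat.find_spec hex
    rw [h] at this
    simp [hi] at this
  -- `Nat.find hex` is the first step down that leaves `A`; it is positive as `i ∈ A`, and the run
  -- ends one step earlier.
  refine ⟨Nat.find hex - 1, fun k hk => not_not.mp (Nat.find_min hex (by omega)), ?_⟩
  have := Nat.find_spec hex
  rwa [show (i - ((Nat.find hex - 1 : ℕ) : ℤ) - 1 : ℤ) = i - (Nat.find hex : ℕ) by omega]

theorem IsCycDecOn.eq_mul_affTransp {A : Finset (ZMod n)} {u w : AffinePerm n} {i : ℤ} {j : ℕ}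
    (hw : IsCycDecOn A w) (hu : IsCycDecOn (A.erase (i : ZMod n)) u)
    (hrun : ∀ k : ℕ, k ≤ j → ((i - k : ℤ) : ZMod n) ∈ A)
    (hend : ((i - j - 1 : ℤ) : ZMod n) ∉ A) :
    w = u * affTransp n (i - j) (i + 1) ∧ ¬ i - j ≡ i + 1 [ZMOD n] ∧
      u.1 (i - j) < u.1 (i + 1) := by
  obtain ⟨h1, h2, h3, h4⟩ := hu.isCycFun.run hrun hend
  exact ⟨hw.isCycFun.eq h1, h2, by omega⟩

/-- Keeps only that the upper index of the reflection is one more than the letter. This suffices for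
the output of `φ`, where the run below the inserted letter is not controlled. -/
theorem IsCycDecOn.exists_eq_mul_affTransp {A : Finset (ZMod n)} {u w : AffinePerm n} {i : ℤ}
    (hw : IsCycDecOn A w) (hi : (i : ZMod n) ∈ A) (hu : IsCycDecOn (A.erase (i : ZMod n)) u) :
    ∃ c, c < i + 1 ∧ w = u * affTransp n c (i + 1) ∧ ¬ c ≡ i + 1 [ZMOD n] ∧
      u.1 c < u.1 (i + 1) := by
  obtain ⟨c, hc⟩ := hw.exists_notMem
  obtain ⟨j, hrun, hend⟩ := exists_run hc hi
  exact ⟨_, by omega, hw.eq_mul_affTransp hu hrun hend⟩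

theorem IsCycDecOn.bruhatCovers {A : Finset (ZMod n)} {u w : AffinePerm n} {i : ZMod n}
    (hw : IsCycDecOn A w) (hi : i ∈ A) (hu : IsCycDecOn (A.erase i) u) : BruhatCovers u w := by
  obtain ⟨x, rfl⟩ := ZMod.intCast_surjective i
  obtain ⟨c, -, h1, h2, -⟩ := hw.exists_eq_mul_affTransp hi hu
  refine ⟨⟨_, _, h2, h1⟩, ?_⟩
  rw [hw.affLength_eq, hu.affLength_eq, Finset.card_erase_add_one hi]

theorem IsCycDecWord.isCycDecOn_eraseIdx {a : List (ZMod n)} (ha : IsCycDecWord a) {p : ℕ}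
    (hp : p < a.length) {u : AffinePerm n} (hu : wordProd (a.eraseIdx p) = u) :
    IsCycDecOn (a.toFinset.erase a[p]) u := by
  refine ⟨a.eraseIdx p, ?_, hu, ?_⟩
  · rw [isCycDecWord_iff] at ha ⊢
    exact ha.sublist (List.eraseIdx_sublist a p)
  · ext t
    rw [← ha.2.1.erase_getElem p hp, List.mem_toFinset, ha.2.1.mem_erase_iff, Finset.mem_erase,
      List.mem_toFinset]

/-- By the exchange property the cover deletes a letter of a chosen cyclically decreasing word.
Hence everything covered by a cyclically decreasing element is again cyclically decreasing, and `φ`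
applies at every mark. -/
theorem IsCycDecOn.exists_erase {A : Finset (ZMod n)} {u w : AffinePerm n}
    (hw : IsCycDecOn A w) (h : BruhatCovers u w) : ∃ i ∈ A, IsCycDecOn (A.erase i) u := by
  obtain ⟨a, ha, rfl, rfl⟩ := hw
  obtain ⟨⟨x, y, hxy, e⟩, hlen⟩ := h
  have e' : u = wordProd a * affTransp n x y := by rw [e, mul_affTransp_mul_affTransp]
  have hlt : affLength (wordProd a * affTransp n x y) < affLength (wordProd a) := by
    rw [← e']; omega
  rw [affLength_mul_affTransp_lt_iff _ hxy] at hlt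
  obtain ⟨p, hp, he⟩ := exists_wordProd_eraseIdx a hxy hlt
  exact ⟨a[p], by simp, ha.isCycDecOn_eraseIdx hp (he.trans e'.symm)⟩

end CycDec

/-! ### The map on the factors -/

section CycPhi

variable {n : ℕ}

theorem cycPhi_iff {v w u : AffinePerm n} : CycPhi v w u ↔
    ∃ (A : Finset (ZMod n)) (i : ℤ) (j : ℕ), (i : ZMod n) ∈ A ∧ IsCycDecOn A w ∧
      IsCycDecOn (A.erase (i : ZMod n)) v ∧
      (∀ k : ℕ, k ≤ j → ((i - k : ℤ) : ZMod n) ∈ A) ∧ ((i - j - 1 : ℤ) : ZMod n) ∉ A ∧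
      IsCycDecOn (insert ((i - j - 1 : ℤ) : ZMod n) (A.erase (i : ZMod n))) u := by
  constructor
  · rintro ⟨A, i, j, h1, h2, h3, h4, h5, h6⟩
    obtain ⟨x, rfl⟩ := ZMod.intCast_surjective i
    refine ⟨A, x, j, h1, h2, h3, ?_, ?_, ?_⟩ <;> push_cast
    exacts [h4, h5, h6]
  · rintro ⟨A, i, j, h1, h2, h3, h4, h5, h6⟩
    push_cast at h4 h5 h6
    exact ⟨A, _, j, h1, h2, h3, h4, h5, h6⟩

variable [Fact (1 < n)]

theorem CycPhi.unique {v w u u' : AffinePerm n} (h : CycPhi v w u) (h' : CycPhi v w u') :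
    u = u' := by
  obtain ⟨A, i, j, h1, h2, h3, h4, h5, h6⟩ := h
  obtain ⟨A', i', j', h1', h2', h3', h4', h5', h6'⟩ := h'
  obtain rfl := h2.isCycFun.eq_set h2'.isCycFun
  have e := h3.isCycFun.eq_set h3'.isCycFun
  obtain rfl : i = i' := by
    by_contra hne
    have h7 : i ∈ A.erase i' := Finset.mem_erase.mpr ⟨hne, h1⟩
    rw [← e] at h7
    exact Finset.notMem_erase _ _ h7
  obtain rfl : j = j' := by
    rcases lt_trichotomy j j' with h | h | h
    · exact absurd (by simpa [sub_sub] using h4' (j + 1) h) h5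
    · exact h
    · exact absurd (by simpa [sub_sub] using h4 (j' + 1) h) h5'
  exact h6.isCycFun.eq h6'.isCycFun

theorem existsUnique_cycPhi {v w : AffinePerm n} (hw : IsCycDec w) (h : BruhatCovers v w) :
    ∃! u, CycPhi v w u := by
  obtain ⟨A, hA⟩ := isCycDec_iff.mp hw
  obtain ⟨i, hi, hv⟩ := hA.exists_erase h
  obtain ⟨x, rfl⟩ := ZMod.intCast_surjective i
  obtain ⟨c, hc⟩ := hA.exists_notMem
  obtain ⟨j, hrun, hend⟩ := exists_run hc hi
  -- The vacated letter `x` is missing from the new set, which is therefore proper.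
  obtain ⟨u, hu⟩ := exists_isCycDecOn
    (A := insert ((x - j - 1 : ℤ) : ZMod n) (A.erase (x : ZMod n))) (c := (x : ZMod n)) (by
      rw [Finset.mem_insert, not_or]
      exact ⟨fun e => hend (e ▸ hi), Finset.notMem_erase _ _⟩)
  have hu' := cycPhi_iff.mpr ⟨A, x, j, hi, hA, hv, hrun, hend, hu⟩
  exact ⟨u, hu', fun u' h' => h'.unique hu'⟩

theorem CycPhi.isCycDec {v w u : AffinePerm n} (h : CycPhi v w u) : IsCycDec u := by
  obtain ⟨_, _, _, -, -, -, -, -, hu⟩ := h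
  exact isCycDec_iff.mpr ⟨_, hu⟩

theorem CycPhi.bruhatCovers {v w u : AffinePerm n} (h : CycPhi v w u) : BruhatCovers v u := by
  obtain ⟨A, i, j, hi, -, hv, -, hend, hu⟩ := h
  refine hu.bruhatCovers (Finset.mem_insert_self _ _) ?_
  rwa [Finset.erase_insert (fun h => hend (Finset.mem_of_mem_erase h))]

theorem CycPhi.bruhatCovers_left {v w u : AffinePerm n} (h : CycPhi v w u) :
    BruhatCovers v w := by
  obtain ⟨A, i, j, hi, hw, hv, -⟩ := h
  exact hw.bruhatCovers hi hv

/-- The removed letter `i` has reflection `t_{i-j,i+1}`. The inserted letter `i - j - 1` has upper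
index `i - j`, so `c = i - j` passes from lower to upper index. -/
theorem CycPhi.exists_affTransp {v w u : AffinePerm n} (h : CycPhi v w u) : ∃ d c e : ℤ,
    c < e ∧ ¬ c ≡ e [ZMOD n] ∧ w = v * affTransp n c e ∧
    d < c ∧ ¬ d ≡ c [ZMOD n] ∧ v.1 d < v.1 c ∧ u = v * affTransp n d c := by
  obtain ⟨A, i, j, hi, hw, hv, hrun, hend, hu⟩ := cycPhi_iff.mp h
  obtain ⟨h1, h2, -⟩ := hw.eq_mul_affTransp hv hrun hend
  obtain ⟨d, h3, h4, h5, h6⟩ := hu.exists_eq_mul_affTransp (u := v)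
    (Finset.mem_insert_self _ _)
    (by rwa [Finset.erase_insert (fun h => hend (Finset.mem_of_mem_erase h))])
  rw [sub_add_cancel] at h3 h4 h5 h6
  exact ⟨d, i - j, i + 1, by omega, h2, h1, h3, h5, h6, h4⟩

/-- From `v` and `u` one recovers `A` without `i`, and the inserted letter `i - j - 1`; then `i` is
the first letter above it that does not belong to `A` without `i`. -/
theorem CycPhi.injective {v w w' u : AffinePerm n} (h : CycPhi v w u) (h' : CycPhi v w' u) :
    w = w' := by
  obtain ⟨A, i, j, h1, h2, h3, h4, h5, h6⟩ := cycPhi_iff.mp h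
  obtain ⟨A', i', j', h1', h2', h3', h4', h5', h6'⟩ := cycPhi_iff.mp h'
  have e := h3.isCycFun.eq_set h3'.isCycFun
  have e2 := h6.isCycFun.eq_set h6'.isCycFun
  have e3 : ((i - j - 1 : ℤ) : ZMod n) = ((i' - j' - 1 : ℤ) : ZMod n) := by
    have h7 : ((i - j - 1 : ℤ) : ZMod n) ∈
        insert ((i' - j' - 1 : ℤ) : ZMod n) (A'.erase (i' : ZMod n)) := by
      rw [← e2]; exact Finset.mem_insert_self _ _
    rcases Finset.mem_insert.mp h7 with h8 | h8
    · exact h8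
    · rw [← e] at h8
      exact absurd (Finset.mem_of_mem_erase h8) h5
  rw [ZMod.intCast_eq_intCast_iff] at e3
  -- Both runs start just above the same residue. If one were shorter, its top letter would lie
  -- strictly inside the other run, hence in the common set from which that letter was removed.
  have hj : j = j' := by
    rcases lt_trichotomy j j' with h | h | h
    · have h8 := run_mem_erase h4' h5' (z := i' - j' + j) (by omega) (by omega)
      rw [← e, ← (ZMod.intCast_eq_intCast_iff _ _ _).mpr
        (show i ≡ i' - j' + j [ZMOD n] by convert e3.add_right (j + 1) using 1 <;> ring)] at h8
      exact absurd h8 (Finset.notMem_erase _ _)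
    · exact h
    · have h8 := run_mem_erase h4 h5 (z := i - j + j') (by omega) (by omega)
      rw [e, ← (ZMod.intCast_eq_intCast_iff _ _ _).mpr
        (show i' ≡ i - j + j' [ZMOD n] by
          convert e3.symm.add_right (j' + 1) using 1 <;> ring)] at h8
      exact absurd h8 (Finset.notMem_erase _ _)
  subst hj
  have hi : (i : ZMod n) = i' := by
    rw [ZMod.intCast_eq_intCast_iff]
    convert e3.add_right (j + 1) using 1 <;> ring
  have hA : A = A' := by
    rw [← Finset.insert_erase h1, ← Finset.insert_erase h1', e, hi]
  subst hA
  exact h2.isCycFun.eq h2'.isCycFun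

end CycPhi

/-! ### One step of the generalized algorithm -/

section Step

variable {n m : ℕ}

theorem getD_ofFn (D : Fin m → AffinePerm n) (k : Fin m) : (List.ofFn D).getD k 1 = D k := by
  simp [List.getD_eq_getElem?_getD]

theorem ofFn_set (D : Fin m → AffinePerm n) (k : Fin m) (u : AffinePerm n) :
    (List.ofFn D).set k u = List.ofFn (Function.update D k u) := by
  apply List.ext_getElem
  · simp
  · intro l h1 h2
    rw [List.getElem_set]
    simp only [List.getElem_ofFn, Function.update_apply, Fin.ext_iff]
    split_ifs with h3 h4 h4
    · rfl
    · exact absurd h3.symm h4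
    · exact absurd h4.symm h3
    · rfl

/-- The factors are cyclically decreasing of lengths `α`, of total length `ℓ(v) + 1`. -/
def IsAdmissible (α : Fin m → ℕ) (v : AffinePerm n) (D : Fin m → AffinePerm n) : Prop :=
  ∑ k, α k = affLength v + 1 ∧ ∀ k, IsCycDec (D k) ∧ affLength (D k) = α k

variable {α : Fin m → ℕ} {v : AffinePerm n}

theorem IsAdmissible.sum_eq {D : Fin m → AffinePerm n} (h : IsAdmissible α v D) :
    ((List.ofFn D).map affLength).sum = affLength v + 1 := by
  rw [List.map_ofFn, List.sum_ofFn, ← h.1]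
  exact Finset.sum_congr rfl fun k _ => (h.2 k).2

theorem IsAdmissible.isTerminal_iff {S : LittleState n m} (h : IsAdmissible α v S.factors) :
    IsTerminal α S ↔ affLength (List.ofFn S.factors).prod = affLength v + 1 := by
  constructor
  · rintro ⟨w, h1, -, rfl⟩
    rw [← h1, h.1]
  · exact fun h1 => ⟨_, by rw [h1, h.1], h.2, rfl⟩

theorem IsMarkedBy.unique {S : LittleState n m} {u u' : AffinePerm n} (h : IsMarkedBy v S u)
    (h' : IsMarkedBy v S u') : u = u' := by
  have e := h.2.trans h'.2.symm
  rw [← ofFn_set, ← ofFn_set, prod_set_eq_mul_rightProd _ (by simp),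
    prod_set_eq_mul_rightProd _ (by simp)] at e
  exact mul_left_cancel (mul_right_cancel e)

variable [Fact (1 < n)]

theorem isMarkedBy_iff {S : LittleState n m} {u : AffinePerm n} : IsMarkedBy v S u ↔
    BruhatCovers u (S.factors S.idx) ∧ ((List.ofFn S.factors).set S.idx u).prod = v := by
  rw [IsMarkedBy, removesOne_iff, ofFn_set]

theorem exists_isMarkedBy_iff {S : LittleState n m} :
    (∃ u, IsMarkedBy v S u) ↔ IsMark v (List.ofFn S.factors) S.idx := by
  simp only [isMarkedBy_iff, IsMark, getD_ofFn]

theorem isLittleState_iff {S : LittleState n m} : IsLittleState α v S ↔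
    IsAdmissible α v S.factors ∧ IsMark v (List.ofFn S.factors) S.idx := by
  rw [IsLittleState, exists_isMarkedBy_iff, IsAdmissible, and_assoc]

/-- The new factor covers the same `u` as the old one, so the old index is still a mark. -/
theorem IsMarkedBy.lower {S : LittleState n m} {u z : AffinePerm n} (hu : IsMarkedBy v S u)
    (hz : CycPhi u (S.factors S.idx) z) :
    IsMarkedBy v ⟨Function.update S.factors S.idx z, S.idx⟩ u := by
  refine ⟨?_, ?_⟩
  · rw [removesOne_iff]
    simpa using hz.bruhatCovers
  · simpa using hu.2

theorem IsAdmissible.lower {S : LittleState n m} {u z : AffinePerm n}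
    (h : IsAdmissible α v S.factors) (hz : CycPhi u (S.factors S.idx) z) :
    IsAdmissible α v (Function.update S.factors S.idx z) := by
  refine ⟨h.1, fun k => ?_⟩
  by_cases hk : k = S.idx
  · subst hk
    rw [Function.update_self]
    exact ⟨hz.isCycDec, by rw [← (h.2 _).2, hz.bruhatCovers.2, hz.bruhatCovers_left.2]⟩
  · rw [Function.update_of_ne hk]
    exact h.2 k

theorem LittleStep.isAdmissible {S T : LittleState n m} (h : LittleStep α v S T)
    (hS : IsLittleState α v S) : IsAdmissible α v T.factors := by
  obtain ⟨u, z, -, hz, hT, -⟩ := h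
  rw [hT]
  exact (isLittleState_iff.mp hS).1.lower hz

theorem LittleStep.isLittleState {S T : LittleState n m} (h : LittleStep α v S T)
    (hS : IsLittleState α v S) : IsLittleState α v T := by
  have hadm := h.isAdmissible hS
  obtain ⟨u, z, hu, hz, hT, ⟨-, hidx⟩ | ⟨-, -, hm⟩⟩ := h
  · refine isLittleState_iff.mpr ⟨hadm, exists_isMarkedBy_iff.mp ⟨u, ?_⟩⟩
    have := hu.lower hz
    rwa [← hT, ← hidx] at this
  · exact isLittleState_iff.mpr ⟨hadm, exists_isMarkedBy_iff.mp hm⟩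

theorem IsMark.exists_ne_of_not_additive {D : Fin m → AffinePerm n} {i : Fin m}
    (h : IsMark v (List.ofFn D) i) (hD : IsAdmissible α v D)
    (hadd : affLength (List.ofFn D).prod ≠ affLength v + 1) :
    ∃ j : Fin m, j ≠ i ∧ IsMark v (List.ofFn D) j := by
  obtain ⟨s, r, hw⟩ := h.exists_wirePair
  obtain ⟨j, hj, hw'⟩ := hw.exists_ne hD.sum_eq hadd
  have hlt : j < m := by simpa using hw'.lt_length
  exact ⟨⟨j, hlt⟩, fun e => hj (by rw [← e]), hw'.isMark hD.sum_eq⟩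

theorem IsMark.eq_of_ne_of_ne {D : Fin m → AffinePerm n} {i j k : Fin m}
    (hi : IsMark v (List.ofFn D) i) (hj : IsMark v (List.ofFn D) j)
    (hk : IsMark v (List.ofFn D) k) (hD : IsAdmissible α v D) (hji : j ≠ i) (hki : k ≠ i) :
    j = k := by
  have := hi.eq_or_eq_or_eq hj hk hD.sum_eq
  rw [← Fin.ext_iff, ← Fin.ext_iff, ← Fin.ext_iff] at this
  tauto

/-- The lowered factor remains marked. If the result is additive the algorithm stops there;
otherwise a second mark exists by `WirePair.exists_ne`, and there is no third. -/
theorem existsUnique_littleStep {S : LittleState n m} (hS : IsLittleState α v S) :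
    ∃! T, LittleStep α v S T := by
  obtain ⟨hadm, hmark⟩ := isLittleState_iff.mp hS
  obtain ⟨u, hu⟩ := exists_isMarkedBy_iff.mpr hmark
  obtain ⟨z, hz, hz'⟩ := existsUnique_cycPhi (hadm.2 S.idx).1 (isMarkedBy_iff.mp hu).1
  have hlow := exists_isMarkedBy_iff.mp ⟨u, hu.lower hz⟩
  have hadm' := hadm.lower hz
  have hfac : ∀ {T}, LittleStep α v S T → T.factors = Function.update S.factors S.idx z := by
    rintro T ⟨u', z', hu', hzz, hT, -⟩
    obtain rfl := hu.unique hu'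
    rw [hT, hz' z' hzz]
  by_cases hterm : IsTerminal α ⟨Function.update S.factors S.idx z, S.idx⟩
  · refine ⟨_, ⟨u, z, hu, hz, rfl, Or.inl ⟨hterm, rfl⟩⟩, ?_⟩
    rintro ⟨F, i⟩ hT
    obtain rfl : F = _ := hfac hT
    obtain ⟨-, -, -, -, -, ⟨-, hidx⟩ | ⟨hnt, -⟩⟩ := hT
    · exact congrArg _ hidx
    · exact absurd hterm hnt
  · obtain ⟨j, hj, hj'⟩ := hlow.exists_ne_of_not_additive hadm'
      (fun h => hterm (hadm'.isTerminal_iff.mpr h))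
    refine ⟨⟨Function.update S.factors S.idx z, j⟩, ⟨u, z, hu, hz, rfl, Or.inr
      ⟨hterm, hj, exists_isMarkedBy_iff.mpr hj'⟩⟩, ?_⟩
    rintro ⟨F, i⟩ hT
    obtain rfl : F = _ := hfac hT
    obtain ⟨-, -, -, -, -, ⟨hterm', -⟩ | ⟨-, hne, hm⟩⟩ := hT
    · exact absurd hterm' hterm
    · exact congrArg _ (hlow.eq_of_ne_of_ne (exists_isMarkedBy_iff.mp hm) hj' hadm' hne hj)

/-- The previous index is that of `T` if `T` is terminal, and otherwise the only other mark of `T`.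
This mark determines `u`, and `φ` is injective for fixed `u`. -/
theorem LittleStep.injective {S S' T : LittleState n m} (h : LittleStep α v S T)
    (h' : LittleStep α v S' T) (hS : IsLittleState α v S) : S = S' := by
  have hadm := h.isAdmissible hS
  obtain ⟨u, z, hu, hz, hT, hcase⟩ := h
  obtain ⟨u', z', hu', hz', hT', hcase'⟩ := h'
  have hl := hu.lower hz
  have hl' := hu'.lower hz'
  rw [← hT] at hl
  rw [← hT'] at hl'
  have hidx : S.idx = S'.idx := by
    rcases hcase with ⟨ht, hi⟩ | ⟨ht, hi, hm⟩ <;>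
      rcases hcase' with ⟨ht', hi'⟩ | ⟨ht', hi', -⟩
    · rw [← hi, ← hi']
    · exact absurd ht ht'
    · exact absurd ht' ht
    · exact IsMark.eq_of_ne_of_ne (exists_isMarkedBy_iff.mp hm)
        (exists_isMarkedBy_iff.mp ⟨u, hl⟩) (exists_isMarkedBy_iff.mp ⟨u', hl'⟩) hadm
        hi.symm hi'.symm
  obtain ⟨D, i⟩ := S
  obtain ⟨D', i'⟩ := S'
  obtain rfl : i = i' := hidx
  obtain rfl := hl.unique hl'
  have hzz : z = z' := by
    have := hT.symm.trans hT'
    simpa using congrFun this i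
  subst hzz
  have hi : D i = D' i := hz.injective hz'
  congr 1
  funext k
  by_cases hk : k = i
  · rw [hk, hi]
  · have := congrFun (hT.symm.trans hT') k
    simpa [hk] using this

/-- A step keeps the lower exchanged wire, until the algorithm stops, when this wire has become
the upper one. -/
theorem LittleStep.wirePair {S T : LittleState n m} (h : LittleStep α v S T)
    (hS : IsLittleState α v S) {r s : ℤ} (hw : WirePair v (List.ofFn S.factors) S.idx r s) :
    (IsTerminal α T → ∃ q, WirePair v (List.ofFn T.factors) T.idx q r) ∧
    (¬ IsTerminal α T → ∃ q, WirePair v (List.ofFn T.factors) T.idx r q) := by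
  have hadm := h.isAdmissible hS
  obtain ⟨u, z, hu, hz, hT, hcase⟩ := h
  obtain ⟨d, c, e, h1, h2, h3, h4, h5, h6, h7⟩ := hz.exists_affTransp
  -- The wire `r` is now the upper one at the old index, with a new partner `q`.
  obtain ⟨q, hq⟩ := hw.set (isMarkedBy_iff.mp hu).2 h1 h2 (by rwa [getD_ofFn]) h4 h5 h6 h7
  rw [ofFn_set, ← hT] at hq
  rcases hcase with ⟨ht, hi⟩ | ⟨ht, hi, hm⟩
  · exact ⟨fun _ => ⟨q, by rwa [hi]⟩, fun h => absurd ht h⟩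
  · refine ⟨fun h => absurd h ht, fun _ => ⟨q, ?_⟩⟩
    -- The other crossing of `q` and `r` has the opposite orientation, so `r` is lower there; the
    -- bound on the number of marks identifies it with `T.idx`.
    obtain ⟨j, hj, hj'⟩ := hq.exists_ne hadm.sum_eq (fun h => ht (hadm.isTerminal_iff.mpr h))
    have hlt : j < m := by simpa using hj'.lt_length
    have := IsMark.eq_of_ne_of_ne (i := S.idx) (j := ⟨j, hlt⟩) (hq.isMark hadm.sum_eq)
      (hj'.isMark hadm.sum_eq) (exists_isMarkedBy_iff.mp hm) hadm
      (fun e => hj (by rw [← e])) hi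
    rwa [← this]

/-! ### Finiteness of the set of states -/

theorem finite_isCycDec : {w : AffinePerm n | IsCycDec w}.Finite := by
  classical
  refine Set.Finite.subset (Set.finite_range fun A : Finset (ZMod n) =>
    if h : ∃ w, IsCycDecOn A w then h.choose else 1) ?_
  intro w hw
  obtain ⟨A, hA⟩ := isCycDec_iff.mp hw
  have h : ∃ w, IsCycDecOn A w := ⟨w, hA⟩
  exact ⟨A, by simp only [dif_pos h]; exact h.choose_spec.isCycFun.eq hA.isCycFun⟩

theorem finite_isLittleState (α : Fin m → ℕ) (v : AffinePerm n) :
    {S : LittleState n m | IsLittleState α v S}.Finite := by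
  have h1 : {D : Fin m → AffinePerm n | ∀ k, D k ∈ {w : AffinePerm n | IsCycDec w}}.Finite :=
    Set.Finite.pi' fun _ => finite_isCycDec
  refine ((h1.prod (Set.finite_univ (α := Fin m))).image
    fun p => (⟨p.1, p.2⟩ : LittleState n m)).subset ?_
  rintro ⟨D, i⟩ hS
  exact ⟨(D, i), ⟨fun k => (hS.2.1 k).1, Set.mem_univ _⟩, rfl⟩

end Step

/-! ### First returns -/

section FirstReturn

variable {X : Type} {R : X → X → Prop} {P : X → Prop} {S : Set X}

/-- Splits off the last step and turns the rest into a path whose vertices after `x` avoid `P`, a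
form that can be followed backwards. -/
theorem FirstHit.exists_last {x z : X} (h : FirstHit R P x z) (hx : x ∈ S)
    (hmem : ∀ x y, x ∈ S → R x y → y ∈ S) :
    P z ∧ z ∈ S ∧ ∃ w ∈ S, Relation.ReflTransGen (fun a b => a ∈ S ∧ R a b ∧ ¬ P b) x w ∧
      R w z := by
  induction h with
  | hit h hP => exact ⟨hP, hmem _ _ hx h, _, hx, .refl, h⟩
  | next h hP _ ih =>
    obtain ⟨h1, h2, w, hw, h3, h4⟩ := ih (hmem _ _ hx h)
    exact ⟨h1, h2, w, hw, .head ⟨hx, h, hP⟩ h3, h4⟩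

theorem FirstHit.unique {x z z' : X} (h : FirstHit R P x z) (h' : FirstHit R P x z')
    (hx : x ∈ S) (hmem : ∀ x y, x ∈ S → R x y → y ∈ S) (hstep : ∀ x ∈ S, ∃! y, R x y) :
    z = z' := by
  induction h with
  | hit h hP =>
    cases h' with
    | hit h' _ => exact (hstep _ hx).unique h h'
    | next h' hP' _ => exact absurd ((hstep _ hx).unique h h' ▸ hP) hP'
  | next h hP _ ih =>
    cases h' with
    | hit h' hP' => exact absurd ((hstep _ hx).unique h' h ▸ hP') hP
    | next h' _ hrest => exact ih ((hstep _ hx).unique h' h ▸ hrest) (hmem _ _ hx h)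

theorem FirstHit.injective {x x' z : X} (h : FirstHit R P x z) (h' : FirstHit R P x' z)
    (hx : x ∈ S) (hx' : x' ∈ S) (hP : P x) (hP' : P x')
    (hmem : ∀ x y, x ∈ S → R x y → y ∈ S)
    (hinj : ∀ x x' y, x ∈ S → x' ∈ S → R x y → R x' y → x = x') : x = x' := by
  obtain ⟨-, -, w, hw, h1, h2⟩ := h.exists_last hx hmem
  obtain ⟨-, -, w', hw', h1', h2'⟩ := h'.exists_last hx' hmem
  obtain rfl := hinj _ _ _ hw hw' h2 h2'
  have hU : Relator.RightUnique (Function.swap fun a b => a ∈ S ∧ R a b ∧ ¬ P b) :=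
    fun a b c hab hac => hinj _ _ _ hab.1 hac.1 hab.2.1 hac.2.1
  rcases Relation.ReflTransGen.total_of_right_unique hU
    (Relation.reflTransGen_swap.mpr h1) (Relation.reflTransGen_swap.mpr h1') with h3 | h3 <;>
  rcases (Relation.reflTransGen_swap.mp h3).cases_tail with h4 | ⟨c, -, h4⟩
  · exact h4
  · exact absurd hP h4.2.2
  · exact h4.symm
  · exact absurd hP' h4.2.2

/-- The steps form an injective self-map of a finite set, so the orbit of `x` comes back to `x`,
where `P` holds; some first hit occurs no later. -/
theorem exists_firstHit (hfin : S.Finite) (hmem : ∀ x y, x ∈ S → R x y → y ∈ S)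
    (hstep : ∀ x ∈ S, ∃! y, R x y)
    (hinj : ∀ x x' y, x ∈ S → x' ∈ S → R x y → R x' y → x = x') {x : X} (hx : x ∈ S)
    (hP : P x) : ∃ z, FirstHit R P x z := by
  choose f hf _ using fun x : S => hstep x.1 x.2
  let F : S → S := fun x => ⟨f x, hmem _ _ x.2 (hf x)⟩
  have hF : Function.Injective F := fun a b hab => by
    have e : f a = f b := congrArg Subtype.val hab
    exact Subtype.ext (hinj _ _ _ a.2 b.2 (hf a) (e ▸ hf b))
  have : Finite S := hfin
  obtain ⟨N, hN, hper⟩ := hF.mem_periodicPts ⟨x, hx⟩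
  have main : ∀ (N : ℕ) (y : S), P (F^[N + 1] y).1 → ∃ z, FirstHit R P y.1 z := by
    intro N
    induction N with
    | zero => exact fun y hy => ⟨_, .hit (hf y) hy⟩
    | succ N ih =>
      intro y hy
      by_cases h : P (F y).1
      · exact ⟨_, .hit (hf y) h⟩
      · obtain ⟨z, hz⟩ := ih (F y) hy
        exact ⟨z, .next (hf y) h hz⟩
  refine main (N - 1) ⟨x, hx⟩ ?_
  rw [Nat.sub_add_cancel hN, hper]
  exact hP

/-- The first return map on the points of `S` satisfying `P` is injective on a finite set, hence
surjective. -/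
theorem exists_firstHit_to (hfin : S.Finite) (hmem : ∀ x y, x ∈ S → R x y → y ∈ S)
    (hstep : ∀ x ∈ S, ∃! y, R x y)
    (hinj : ∀ x x' y, x ∈ S → x' ∈ S → R x y → R x' y → x = x') {z : X} (hz : z ∈ S)
    (hP : P z) : ∃ x ∈ S, P x ∧ FirstHit R P x z := by
  let T : Set X := {x | x ∈ S ∧ P x}
  have : Finite T := hfin.subset fun x hx => hx.1
  choose f hf using fun x : T => exists_firstHit hfin hmem hstep hinj x.2.1 x.2.2
  let F : T → T := fun x =>
    ⟨f x, ((hf x).exists_last x.2.1 hmem).2.1, ((hf x).exists_last x.2.1 hmem).1⟩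
  have hF : Function.Injective F := fun a b hab => by
    have e : f a = f b := congrArg Subtype.val hab
    exact Subtype.ext ((hf a).injective (e ▸ hf b) a.2.1 b.2.1 a.2.2 b.2.2 hmem hinj)
  obtain ⟨x, hx⟩ := Finite.surjective_of_injective hF ⟨z, hz, hP⟩
  have e : f x = z := congrArg Subtype.val hx
  exact ⟨x, x.2.1, x.2.2, e ▸ hf x⟩

end FirstReturn

/-! ### The output of the generalized algorithm -/

section Output

variable {n m : ℕ} [Fact (1 < n)] {α : Fin m → ℕ} {v : AffinePerm n}

omit [Fact (1 < n)] in
theorem IsAlphaDecomp.isAdmissible {w : AffinePerm n} {D : Fin m → AffinePerm n}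
    (h : IsAlphaDecomp α w D) (hw : affLength w = affLength v + 1) : IsAdmissible α v D :=
  ⟨h.1.trans hw, h.2.1⟩

theorem exists_wirePair_of_mem_alphaDecomps_right {D : Fin m → AffinePerm n} {r : ℤ}
    (h : D ∈ alphaDecomps α (rightCovers r v)) : ∃ (i : Fin m) (s : ℤ),
      IsLittleState α v ⟨D, i⟩ ∧ IsTerminal α ⟨D, i⟩ ∧ WirePair v (List.ofFn D) i r s := by
  obtain ⟨w, hw, hD⟩ := h
  have hadm := hD.isAdmissible hw.1.2
  obtain ⟨i, s, hi⟩ := exists_wirePair_of_mem_rightCovers (L := List.ofFn D) (hD.2.2.symm ▸ hw)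
  have hlt : i < m := by simpa using hi.lt_length
  exact ⟨⟨i, hlt⟩, s, isLittleState_iff.mpr ⟨hadm, hi.isMark hadm.sum_eq⟩, ⟨w, hD⟩, hi⟩

theorem exists_wirePair_of_mem_alphaDecomps_left {D : Fin m → AffinePerm n} {r : ℤ}
    (h : D ∈ alphaDecomps α (leftCovers r v)) : ∃ (i : Fin m) (s : ℤ),
      IsLittleState α v ⟨D, i⟩ ∧ IsTerminal α ⟨D, i⟩ ∧ WirePair v (List.ofFn D) i s r := by
  obtain ⟨w, hw, hD⟩ := h
  have hadm := hD.isAdmissible hw.1.2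
  obtain ⟨i, s, hi⟩ := exists_wirePair_of_mem_leftCovers (L := List.ofFn D) (hD.2.2.symm ▸ hw)
  have hlt : i < m := by simpa using hi.lt_length
  exact ⟨⟨i, hlt⟩, s, isLittleState_iff.mpr ⟨hadm, hi.isMark hadm.sum_eq⟩, ⟨w, hD⟩, hi⟩

theorem IsLittleState.prod_mem_rightCovers {S : LittleState n m} (hS : IsLittleState α v S)
    (ht : IsTerminal α S) {r s : ℤ} (hw : WirePair v (List.ofFn S.factors) S.idx r s) :
    (List.ofFn S.factors).prod ∈ rightCovers r v := by
  have hadm := (isLittleState_iff.mp hS).1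
  exact hw.mem_rightCovers hadm.sum_eq (hadm.isTerminal_iff.mp ht)

theorem IsLittleState.prod_mem_leftCovers {S : LittleState n m} (hS : IsLittleState α v S)
    (ht : IsTerminal α S) {r s : ℤ} (hw : WirePair v (List.ofFn S.factors) S.idx s r) :
    (List.ofFn S.factors).prod ∈ leftCovers r v := by
  have hadm := (isLittleState_iff.mp hS).1
  exact hw.mem_leftCovers hadm.sum_eq (hadm.isTerminal_iff.mp ht)

omit [Fact (1 < n)] in
theorem mem_alphaDecomps_of_isTerminal {S : LittleState n m} (ht : IsTerminal α S)
    {C : Set (AffinePerm n)} (h : (List.ofFn S.factors).prod ∈ C) :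
    S.factors ∈ alphaDecomps α C := by
  obtain ⟨w, hw⟩ := ht
  exact ⟨w, hw.2.2 ▸ h, hw⟩

theorem eq_idx_of_isTerminal {D : Fin m → AffinePerm n} {i j : Fin m}
    (hi : IsLittleState α v ⟨D, i⟩) (hj : IsLittleState α v ⟨D, j⟩)
    (ht : IsTerminal α ⟨D, i⟩) : i = j := by
  obtain ⟨hadm, hm⟩ := isLittleState_iff.mp hi
  exact Fin.ext (hm.eq_of_additive (isLittleState_iff.mp hj).2
    (by rw [hadm.sum_eq, hadm.isTerminal_iff.mp ht]))

theorem existsUnique_isLittleState {D : Fin m → AffinePerm n} {r : ℤ}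
    (h : D ∈ alphaDecomps α (rightCovers r v)) : ∃! i, IsLittleState α v ⟨D, i⟩ := by
  obtain ⟨i, -, h1, h2, -⟩ := exists_wirePair_of_mem_alphaDecomps_right h
  exact ⟨i, h1, fun j hj => (eq_idx_of_isTerminal h1 hj h2).symm⟩

/-- The wire `r` is lower at every intermediate mark and becomes upper only at the final one. -/
theorem wirePair_of_firstHit {S T : LittleState n m}
    (h : FirstHit (LittleStep α v) (IsTerminal α) S T) (hS : IsLittleState α v S) {r s : ℤ}
    (hw : WirePair v (List.ofFn S.factors) S.idx r s) :
    ∃ q, WirePair v (List.ofFn T.factors) T.idx q r := by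
  induction h generalizing s with
  | hit h hP => exact (h.wirePair hS hw).1 hP
  | next h hP _ ih =>
    obtain ⟨q, hq⟩ := (h.wirePair hS hw).2 hP
    exact ih (h.isLittleState hS) hq

theorem exists_littleOutput {D : Fin m → AffinePerm n} {r : ℤ}
    (h : D ∈ alphaDecomps α (rightCovers r v)) : ∃ E, ∀ E', LittleOutput α v D E' ↔ E' = E := by
  obtain ⟨i, -, h1, h2, -⟩ := exists_wirePair_of_mem_alphaDecomps_right h
  obtain ⟨⟨E, j⟩, hE⟩ := exists_firstHit (finite_isLittleState α v)
    (fun _ _ hS h => LittleStep.isLittleState h hS) (fun _ => existsUnique_littleStep)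
    (fun _ _ _ hS _ h h' => h.injective h' hS) h1 h2
  refine ⟨E, fun E' => ⟨?_, ?_⟩⟩
  · rintro ⟨i', j', h1', hE'⟩
    obtain rfl := eq_idx_of_isTerminal h1 h1' h2
    have := hE'.unique hE (S := {S | IsLittleState α v S}) h1
      (fun _ _ hS h => LittleStep.isLittleState h hS) (fun _ => existsUnique_littleStep)
    exact congrArg LittleState.factors this
  · rintro rfl
    exact ⟨i, j, h1, hE⟩

theorem LittleOutput.mem_alphaDecomps {D E : Fin m → AffinePerm n} {r : ℤ}
    (hD : D ∈ alphaDecomps α (rightCovers r v)) (h : LittleOutput α v D E) :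
    E ∈ alphaDecomps α (leftCovers r v) := by
  obtain ⟨i, s, h1, h2, hw⟩ := exists_wirePair_of_mem_alphaDecomps_right hD
  obtain ⟨i', j, h1', hE⟩ := h
  obtain rfl := eq_idx_of_isTerminal h1 h1' h2
  obtain ⟨q, hq⟩ := wirePair_of_firstHit hE h1 hw
  obtain ⟨ht, hT, -⟩ := hE.exists_last (S := {S | IsLittleState α v S}) h1
    (fun _ _ hS h => LittleStep.isLittleState h hS)
  exact mem_alphaDecomps_of_isTerminal ht (IsLittleState.prod_mem_leftCovers hT ht hq)

theorem LittleOutput.injective {D D' E : Fin m → AffinePerm n} {r : ℤ}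
    (hD : D ∈ alphaDecomps α (rightCovers r v)) (hD' : D' ∈ alphaDecomps α (rightCovers r v))
    (h : LittleOutput α v D E) (h' : LittleOutput α v D' E) : D = D' := by
  obtain ⟨_, _, -, h2, -⟩ := exists_wirePair_of_mem_alphaDecomps_right hD
  obtain ⟨_, _, -, h2', -⟩ := exists_wirePair_of_mem_alphaDecomps_right hD'
  obtain ⟨i, j, h1, hE⟩ := h
  obtain ⟨i', j', h1', hE'⟩ := h'
  have hmem : ∀ S T, S ∈ {S : LittleState n m | IsLittleState α v S} → LittleStep α v S T →
    T ∈ {S : LittleState n m | IsLittleState α v S} :=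
    fun _ _ hS h => LittleStep.isLittleState h hS
  obtain ⟨ht, hT, -⟩ := hE.exists_last (S := {S | IsLittleState α v S}) h1 hmem
  obtain ⟨-, hT', -⟩ := hE'.exists_last (S := {S | IsLittleState α v S}) h1' hmem
  obtain rfl := eq_idx_of_isTerminal hT hT' ht
  exact congrArg LittleState.factors (hE.injective hE' (S := {S | IsLittleState α v S}) h1 h1'
    h2 h2' hmem (fun _ _ _ hS _ h h' => h.injective h' hS))

theorem exists_littleOutput_to {E : Fin m → AffinePerm n} {r : ℤ}
    (hE : E ∈ alphaDecomps α (leftCovers r v)) :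
    ∃ D ∈ alphaDecomps α (rightCovers r v), LittleOutput α v D E := by
  obtain ⟨j, q, h1, h2, hq⟩ := exists_wirePair_of_mem_alphaDecomps_left hE
  obtain ⟨⟨D, i⟩, hS, ht, hhit⟩ := exists_firstHit_to (finite_isLittleState α v)
    (fun _ _ hS h => LittleStep.isLittleState h hS) (fun _ => existsUnique_littleStep)
    (fun _ _ _ hS _ h h' => h.injective h' hS) h1 h2
  obtain ⟨r', s', hw⟩ := (isLittleState_iff.mp hS).2.exists_wirePair
  obtain ⟨q', hq'⟩ := wirePair_of_firstHit hhit hS hw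
  -- The starting state found has some lower wire `r'`, possibly not `r`; since the product of `E`
  -- is a left cover for both, `r' ≡ r`.
  have hr := modEq_of_mem_leftCovers (IsLittleState.prod_mem_leftCovers h1 h2 hq')
    (IsLittleState.prod_mem_leftCovers h1 h2 hq)
  exact ⟨D, mem_alphaDecomps_of_isTerminal ht (rightCovers_congr hr v
    (IsLittleState.prod_mem_rightCovers hS ht hw)), i, j, hS, hhit⟩

theorem exists_bijOn_littleOutput (α : Fin m → ℕ) (v : AffinePerm n) (r : ℤ) :
    ∃ Φ : (Fin m → AffinePerm n) → (Fin m → AffinePerm n),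
      Set.BijOn Φ (alphaDecomps α (rightCovers r v)) (alphaDecomps α (leftCovers r v)) ∧
      ∀ D ∈ alphaDecomps α (rightCovers r v), ∀ E, LittleOutput α v D E ↔ E = Φ D := by
  have hex : ∀ D : Fin m → AffinePerm n, ∃ E, D ∈ alphaDecomps α (rightCovers r v) →
      ∀ E', LittleOutput α v D E' ↔ E' = E := by
    intro D
    by_cases hD : D ∈ alphaDecomps α (rightCovers r v)
    · obtain ⟨E, hE⟩ := exists_littleOutput hD
      exact ⟨E, fun _ => hE⟩
    -- The value of `Φ` outside the domain is immaterial.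
    · exact ⟨D, fun h => absurd h hD⟩
  choose Φ hΦ using hex
  have hout : ∀ D ∈ alphaDecomps α (rightCovers r v), LittleOutput α v D (Φ D) :=
    fun D hD => (hΦ D hD _).mpr rfl
  refine ⟨Φ, ⟨fun D hD => (hout D hD).mem_alphaDecomps hD, ?_, ?_⟩, hΦ⟩
  · intro D hD D' hD' e
    exact (hout D hD).injective hD hD' (e ▸ hout D' hD')
  · intro E hE
    obtain ⟨D, hD, h⟩ := exists_littleOutput_to hE
    exact ⟨D, hD, ((hΦ D hD E).mp h).symm⟩

end Output

/-! ### The algorithm on words -/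

section Words

variable {n : ℕ}

/-- The list of the simple reflections of a word. -/
def letters (a : List (ZMod n)) : List (AffinePerm n) := a.map (simpleRefl n)

theorem letters_prod (a : List (ZMod n)) : (letters a).prod = wordProd a := rfl

theorem letters_getD (a : List (ZMod n)) {k : ℕ} (hk : k < a.length) :
    (letters a).getD k 1 = simpleRefl n a[k] := by
  simp [letters, List.getD_eq_getElem?_getD, hk]

/-- Deleting a letter amounts to lowering its simple reflection to `1`, so marked words are marked
lists with factors of length one. -/
theorem letters_set_one_prod (a : List (ZMod n)) (k : ℕ) :
    ((letters a).set k 1).prod = wordProd (a.eraseIdx k) := by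
  induction a generalizing k with
  | nil => simp [letters, wordProd]
  | cons i a ih =>
    cases k with
    | zero => simp [letters, wordProd]
    | succ k =>
      have := ih k
      simp only [letters] at this
      simp [letters, wordProd_cons, this]

theorem letters_modify (a : List (ZMod n)) {k : ℕ} (hk : k < a.length) :
    letters (a.modify k fun t => t - 1) = (letters a).set k (simpleRefl n (a[k] - 1)) := by
  rw [letters, letters, List.modify_eq_set, List.getElem?_eq_getElem hk, List.map_set]
  simp

variable [Fact (1 < n)] {v : AffinePerm n}

theorem sum_affLength_letters (a : List (ZMod n)) :
    ((letters a).map affLength).sum = a.length := by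
  induction a with
  | nil => rfl
  | cons i a ih =>
    simp only [letters, List.map_cons, List.sum_cons, affLength_simpleRefl] at ih ⊢
    rw [ih, List.length_cons, add_comm]

theorem bruhatCovers_one_simpleRefl (i : ZMod n) : BruhatCovers 1 (simpleRefl n i) := by
  obtain ⟨x, rfl⟩ := ZMod.intCast_surjective i
  exact ⟨⟨x, x + 1, not_modEq_add_one x, by rw [one_mul, simpleRefl_intCast]⟩, by
    rw [affLength_simpleRefl, affLength_one]⟩

theorem IsVMarked.length_eq {x : MarkedWord n} (h : IsVMarked v x) :
    x.word.length = affLength v + 1 := by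
  have h1 := (isReducedWordOf_iff.mp h.2).2
  have h2 := List.length_eraseIdx_of_lt h.1
  have h3 := h.1
  omega

theorem IsVMarked.isMark {x : MarkedWord n} (h : IsVMarked v x) :
    IsMark v (letters x.word) x.idx :=
  ⟨1, by rw [letters_getD _ h.1]; exact bruhatCovers_one_simpleRefl _,
    (letters_set_one_prod _ _).trans h.2.1⟩

theorem IsVMarked.sum_eq {x : MarkedWord n} (h : IsVMarked v x) :
    ((letters x.word).map affLength).sum = affLength v + 1 := by
  rw [sum_affLength_letters, h.length_eq]

theorem IsVMarked.isReducedWord_iff {x : MarkedWord n} (h : IsVMarked v x) :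
    IsReducedWord x.word ↔ affLength (letters x.word).prod = affLength v + 1 := by
  rw [_root_.isReducedWord_iff, h.length_eq, letters_prod, eq_comm]

/-- Lowering a letter replaces `t_{z,z+1}` by `t_{z-1,z}`: the shared index `z` goes from lower to
upper, as it does under `φ`, and the mechanism of `WirePair.set` applies with `u = 1`. -/
theorem LittleEdge.wirePair {x y : MarkedWord n} (h : LittleEdge v x y) {r s : ℤ}
    (hw : WirePair v (letters x.word) x.idx r s) :
    (IsReducedWord y.word → ∃ q, WirePair v (letters y.word) y.idx q r) ∧
    (¬ IsReducedWord y.word → ∃ q, WirePair v (letters y.word) y.idx r q) := by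
  obtain ⟨hx, hy, hword, hcase⟩ := h
  obtain ⟨z, hz⟩ := ZMod.intCast_surjective (x.word[x.idx]'hx.1)
  have hz' := not_modEq_add_one (n := n) (z - 1)
  rw [sub_add_cancel] at hz'
  obtain ⟨q, hq⟩ := hw.set (u := 1) (g' := simpleRefl n ((z : ZMod n) - 1)) (c := z)
    (d := z - 1) (e := z + 1) ((letters_set_one_prod _ _).trans hx.2.1) (by omega)
    (not_modEq_add_one z) (by rw [letters_getD _ hx.1, ← hz, simpleRefl_intCast, one_mul])
    (by omega) hz' (by simp) (by
      have := simpleRefl_intCast (n := n) (z - 1)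
      rw [sub_add_cancel] at this
      rw [one_mul, ← this]; push_cast; rfl)
  rw [hz, ← letters_modify _ hx.1, ← hword] at hq
  rcases hcase with ⟨ht, hi⟩ | ⟨ht, hi⟩
  · exact ⟨fun _ => ⟨q, by rwa [hi]⟩, fun h => absurd ht h⟩
  · refine ⟨fun h => absurd h ht, fun _ => ⟨q, ?_⟩⟩
    obtain ⟨j, hj, hj'⟩ := hq.exists_ne hy.sum_eq (fun h => ht (hy.isReducedWord_iff.mpr h))
    rcases (hq.isMark hy.sum_eq).eq_or_eq_or_eq (hj'.isMark hy.sum_eq) hy.isMark hy.sum_eq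
      with e | e | e
    · exact absurd e.symm hj
    · rwa [← e]
    · exact absurd e.symm hi

theorem FirstHit.littleEdge_wirePair {x y : MarkedWord n}
    (h : FirstHit (LittleEdge v) (fun z => IsReducedWord z.word) x y) {r s : ℤ}
    (hw : WirePair v (letters x.word) x.idx r s) :
    IsVMarked v x ∧ IsVMarked v y ∧ IsReducedWord y.word ∧
      ∃ q, WirePair v (letters y.word) y.idx q r := by
  induction h generalizing s with
  | hit h hP => exact ⟨h.1, h.2.1, hP, (h.wirePair hw).1 hP⟩
  | next h hP _ ih =>
    obtain ⟨q, hq⟩ := (h.wirePair hw).2 hP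
    exact ⟨h.1, (ih hq).2⟩

theorem IsVMarked.isCycDecOn_erase {x : MarkedWord n} (h : IsVMarked v x)
    (hx : IsCycDecWord x.word) :
    IsCycDecOn (x.word.toFinset.erase (x.word[x.idx]'h.1)) v :=
  hx.isCycDecOn_eraseIdx h.1 h.2.1

/-- The algorithm on words induces the map on cyclically decreasing permutations. -/
theorem CycLittle.cycPhi {w u : AffinePerm n} (h : CycLittle v w u) : CycPhi v w u := by
  obtain ⟨x, y, ⟨hxred, hhit⟩, hx, rfl, hy, rfl⟩ := h
  have hmx : IsVMarked v x := by
    cases hhit with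
    | hit h _ => exact h.1
    | next h _ _ => exact h.1
  obtain ⟨r, s, hw⟩ := hmx.isMark.exists_wirePair
  obtain ⟨-, hmy, hyred, q, hq⟩ := hhit.littleEdge_wirePair hw
  have hwx : wordProd x.word ∈ rightCovers r v :=
    hw.mem_rightCovers hmx.sum_eq (hmx.isReducedWord_iff.mp hxred)
  have hwy : wordProd y.word ∈ leftCovers r v :=
    hq.mem_leftCovers hmy.sum_eq (hmy.isReducedWord_iff.mp hyred)
  have hA : IsCycDecOn x.word.toFinset (wordProd x.word) := ⟨_, hx, rfl, rfl⟩
  have hA' : IsCycDecOn y.word.toFinset (wordProd y.word) := ⟨_, hy, rfl, rfl⟩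
  have hB := hmx.isCycDecOn_erase hx
  have hB' := hmy.isCycDecOn_erase hy
  obtain ⟨i, hi⟩ := ZMod.intCast_surjective (x.word[x.idx]'hmx.1)
  obtain ⟨i', hi'⟩ := ZMod.intCast_surjective (y.word[y.idx]'hmy.1)
  have hiA : (i : ZMod n) ∈ x.word.toFinset := by rw [hi]; simp
  have hiA' : (i' : ZMod n) ∈ y.word.toFinset := by rw [hi']; simp
  rw [← hi] at hB
  rw [← hi'] at hB'
  obtain ⟨c, hc⟩ := hA.exists_notMem
  obtain ⟨j, hrun, hend⟩ := exists_run hc hiA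
  obtain ⟨e1, e2, -⟩ := hA.eq_mul_affTransp hB hrun hend
  obtain ⟨d, h1, h2, h3, -⟩ := hA'.exists_eq_mul_affTransp hiA' hB'
  -- The preserved wire is the lower index `i - j` of the first reflection and the upper index `i' +
  -- 1` of the last, both modulo `n`. Hence `i' ≡ i - j - 1`, the letter inserted by `φ`.
  have hr : r ≡ i - j [ZMOD n] :=
    modEq_of_mem_rightCovers hwx ⟨hwx.1, i + 1, by omega, e2, e1⟩
  have hr' : r ≡ i' + 1 [ZMOD n] := modEq_of_mem_leftCovers hwy ⟨hwy.1, d, h1, h3, h2⟩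
  have hi'' : ((i - j - 1 : ℤ) : ZMod n) = i' := by
    rw [ZMod.intCast_eq_intCast_iff]
    simpa using (hr.symm.trans hr').sub_right 1
  refine cycPhi_iff.mpr ⟨_, i, j, hiA, hA, hB, hrun, hend, ?_⟩
  rw [hi'', hB.isCycFun.eq_set hB'.isCycFun, Finset.insert_erase hiA']
  exact hA'

end Words

/-! ### Cyclically decreasing words on which the algorithm runs -/

section Run

variable {n : ℕ}

/-- The word `x - 1, x - 2, …, x - j`. -/
def downRun (x : ZMod n) : ℕ → List (ZMod n)
  | 0 => []
  | j + 1 => (x - 1) :: downRun (x - 1) j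

theorem map_range'_eq_downRun (c : ZMod n) (k j : ℕ) :
    (List.range' (k + 1) j).map (fun l : ℕ => c - (l : ZMod n)) =
      downRun (c - (k : ZMod n)) j := by
  induction j generalizing k with
  | zero => rfl
  | succ j ih =>
    rw [List.range'_succ, List.map_cons, ih, downRun]
    have e : c - ((k + 1 : ℕ) : ZMod n) = c - (k : ZMod n) - 1 := by push_cast; ring
    rw [e]

theorem simpleRefl_mul_self (i : ZMod n) : simpleRefl n i * simpleRefl n i = 1 :=
  affTransp_mul_self _ _

theorem eraseIdx_append_cons (a b : List (ZMod n)) (i : ZMod n) :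
    (a ++ i :: b).eraseIdx a.length = a ++ b := by
  rw [List.eraseIdx_append_of_length_le le_rfl]
  simp

theorem modify_append_cons (a b : List (ZMod n)) (i : ZMod n) :
    (a ++ i :: b).modify a.length (fun t => t - 1) = a ++ (i - 1) :: b := by
  rw [List.modify_eq_set]
  simp

theorem isVMarked_append_cons {v : AffinePerm n} {a b : List (ZMod n)} (h : IsReducedWordOf (a ++ b) v)
    (i : ZMod n) : IsVMarked v ⟨a ++ i :: b, a.length⟩ :=
  ⟨by simp, by simpa only [eraseIdx_append_cons] using h⟩

variable [Fact (1 < n)] {v : AffinePerm n}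

theorem not_isReducedWord_of_repeat (a b : List (ZMod n)) (i : ZMod n) :
    ¬ IsReducedWord (a ++ i :: i :: b) := by
  rw [isReducedWord_iff]
  have h := affLength_wordProd_le (a ++ b)
  have e : wordProd (a ++ i :: i :: b) = wordProd (a ++ b) := by
    rw [wordProd_append, wordProd_append, wordProd_cons, wordProd_cons, ← mul_assoc (simpleRefl n i),
      simpleRefl_mul_self, one_mul]
  rw [e]
  simp only [List.length_append, List.length_cons] at h ⊢
  omega

/-- Lowering the first letter of a run of consecutive letters lowers them all, one at a time. -/
theorem firstHit_downRun (j : ℕ) (a b : List (ZMod n)) (x : ZMod n)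
    (hred : IsReducedWordOf (a ++ (downRun x j ++ b)) v)
    (hfin : IsReducedWord (a ++ (downRun x j ++ (x - (j : ZMod n) - 1) :: b))) :
    FirstHit (LittleEdge v) (fun z => IsReducedWord z.word)
      ⟨a ++ x :: (downRun x j ++ b), a.length⟩
      ⟨a ++ (downRun x j ++ (x - (j : ZMod n) - 1) :: b), a.length + j⟩ := by
  induction j generalizing a x with
  | zero =>
    simp only [downRun, List.nil_append, Nat.cast_zero, sub_zero, add_zero] at hred hfin ⊢
    exact .hit ⟨isVMarked_append_cons hred x, isVMarked_append_cons hred (x - 1),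
      (modify_append_cons ..).symm, Or.inl ⟨hfin, rfl⟩⟩ hfin
  | succ j ih =>
    have e : x - ((j + 1 : ℕ) : ZMod n) - 1 = x - 1 - (j : ZMod n) - 1 := by push_cast; ring
    rw [e] at hfin ⊢
    simp only [downRun, List.cons_append] at hred hfin ⊢
    have hih := ih (a ++ [x - 1]) (x - 1) (by simpa using hred) (by simpa using hfin)
    -- The lowered letter equals the next letter of the run. The word is thus not reduced, and the
    -- mark moves to the second copy, where the situation repeats with a shorter run.
    have hnr := not_isReducedWord_of_repeat a (downRun (x - 1) j ++ b) (x - 1)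
    have hlen : a.length + (j + 1) = (a ++ [x - 1]).length + j := by simp; omega
    rw [hlen]
    have e1 : a ++ (x - 1) :: (downRun (x - 1) j ++ (x - 1 - (j : ZMod n) - 1) :: b) =
      (a ++ [x - 1]) ++ (downRun (x - 1) j ++ (x - 1 - (j : ZMod n) - 1) :: b) := by simp
    have e2 : a ++ (x - 1) :: (x - 1) :: (downRun (x - 1) j ++ b) =
      (a ++ [x - 1]) ++ (x - 1) :: (downRun (x - 1) j ++ b) := by simp
    rw [e1]
    rw [e2] at hnr
    refine .next (y := ⟨(a ++ [x - 1]) ++ (x - 1) :: (downRun (x - 1) j ++ b),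
      (a ++ [x - 1]).length⟩) ⟨isVMarked_append_cons hred x,
        isVMarked_append_cons (by simpa using hred) (x - 1), ?_, Or.inr ⟨hnr, by simp⟩⟩ hnr hih
    rw [modify_append_cons, e2]

theorem isCycDecWord_map_sub {ks : List ℕ} (hks : ks.Pairwise (· < ·))
    (hlt : ∀ k ∈ ks, 0 < k ∧ k < n) (c : ZMod n) :
    IsCycDecWord (ks.map fun k : ℕ => c - (k : ZMod n)) := by
  refine isCycDecWord_of_pairwise_val (c := c) ?_ (List.pairwise_map.mpr ?_)
  · rw [List.mem_map]
    rintro ⟨k, hk, e⟩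
    rw [sub_eq_self, ZMod.natCast_eq_zero_iff] at e
    have := hlt k hk
    exact absurd (Nat.le_of_dvd this.1 e) (by omega)
  · refine hks.imp_of_mem fun {k l} hk hl h => ?_
    rw [sub_sub_cancel, sub_sub_cancel, ZMod.val_cast_of_lt (hlt k hk).2,
      ZMod.val_cast_of_lt (hlt l hl).2]
    exact h

/-- Cut the circle at a letter `c` outside `A` that also differs from the letter to be inserted.
Reading downwards from `c`, the run `i, …, i - j` is a block with the slot for `i - j - 1` right
behind it, so the algorithm only shifts this block and ends at a cyclically decreasing word. -/
theorem exists_cycLittle {v w : AffinePerm n} (hw : IsCycDec w) (h : BruhatCovers v w)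
    (hlen : affLength w + 1 < n) : ∃ u, CycLittle v w u := by
  obtain ⟨A, hA⟩ := isCycDec_iff.mp hw
  obtain ⟨i, hi, hv⟩ := hA.exists_erase h
  obtain ⟨z, rfl⟩ := ZMod.intCast_surjective i
  obtain ⟨c₀, hc₀⟩ := hA.exists_notMem
  obtain ⟨j, hrun, hend⟩ := exists_run hc₀ hi
  -- The length bound is used here: `A` together with the inserted letter has at most `ℓ(w) + 1 < n`
  -- elements.
  obtain ⟨c, hc⟩ : ∃ c, c ∉ insert ((z - j - 1 : ℤ) : ZMod n) A := by
    by_contra! hall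
    have h1 : insert ((z - j - 1 : ℤ) : ZMod n) A = Finset.univ :=
      Finset.eq_univ_iff_forall.mpr hall
    have h2 := Finset.card_insert_le ((z - j - 1 : ℤ) : ZMod n) A
    rw [h1, Finset.card_univ, ZMod.card, ← hA.affLength_eq] at h2
    omega
  rw [Finset.mem_insert, not_or] at hc
  obtain ⟨hcne, hcA⟩ := hc
  obtain ⟨k₀, hk₀, hz⟩ : ∃ k₀ : ℕ, k₀ < n ∧ (z : ZMod n) = c - (k₀ : ZMod n) :=
    ⟨(c - z).val, ZMod.val_lt _, by simp⟩
  have hrun' : ∀ k : ℕ, k₀ ≤ k → k ≤ k₀ + j → c - (k : ZMod n) ∈ A := by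
    intro k h1 h2
    have := hrun (k - k₀) (by omega)
    push_cast [Nat.cast_sub h1] at this
    rwa [hz, sub_sub, add_sub_cancel] at this
  have hend' : c - ((k₀ + j + 1 : ℕ) : ZMod n) = ((z - j - 1 : ℤ) : ZMod n) := by
    push_cast; rw [hz]; ring
  have hk0 : 0 < k₀ := by
    rcases Nat.eq_zero_or_pos k₀ with rfl | h
    · exact absurd (by simpa using hrun' 0 le_rfl (by omega)) hcA
    · exact h
  have hkn : k₀ + j + 1 < n := by
    by_contra hge
    rcases Nat.lt_or_ge (k₀ + j) n with h1 | h1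
    · have h2 : k₀ + j + 1 = n := by omega
      rw [h2, ZMod.natCast_self, sub_zero] at hend'
      exact hcne hend'
    · have := hrun' n (by omega) h1
      rw [ZMod.natCast_self, sub_zero] at this
      exact hcA this
  -- Letters are encoded by their distance below `c`. The block occupies the distances `k₀, …, k₀ +
  -- j`, the new letter takes `k₀ + j + 1`, and `low` and `high` collect the rest of `A` on either
  -- side.
  let low : List ℕ := (List.range n).filter fun k => k < k₀ ∧ c - (k : ZMod n) ∈ A
  let high : List ℕ := (List.range n).filter fun k => k₀ + j + 1 < k ∧ c - (k : ZMod n) ∈ A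
  have hlow : ∀ k, k ∈ low ↔ k < k₀ ∧ c - (k : ZMod n) ∈ A := by
    intro k
    simp only [low, List.mem_filter, List.mem_range, decide_eq_true_eq]
    exact ⟨fun h => h.2, fun h => ⟨by omega, h⟩⟩
  have hhigh : ∀ k, k ∈ high ↔ k < n ∧ k₀ + j + 1 < k ∧ c - (k : ZMod n) ∈ A := by
    intro k
    simp only [high, List.mem_filter, List.mem_range, decide_eq_true_eq]
  have hlow0 : ∀ k ∈ low, 0 < k := by
    intro k hk
    rcases Nat.eq_zero_or_pos k with rfl | h
    · exact absurd (by simpa using ((hlow 0).mp hk).2) hcA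
    · exact h
  have hplow : low.Pairwise (· < ·) := List.pairwise_lt_range.filter _
  have hphigh : high.Pairwise (· < ·) := List.pairwise_lt_range.filter _
  have hprun : (List.range' (k₀ + 1) j).Pairwise (· < ·) := List.pairwise_lt_range'
  have hsub : ∀ k, (fun k : ℕ => c - (k : ZMod n)) k = c - (k : ZMod n) := fun _ => rfl
  have ex : (low ++ k₀ :: (List.range' (k₀ + 1) j ++ high)).map
      (fun k : ℕ => c - (k : ZMod n)) = low.map (fun k : ℕ => c - (k : ZMod n)) ++
        (z : ZMod n) :: (downRun (z : ZMod n) j ++ high.map fun k : ℕ => c - (k : ZMod n)) := by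
    rw [List.map_append, List.map_cons, List.map_append, map_range'_eq_downRun, hz]
  have ey : (low ++ (List.range' (k₀ + 1) j ++ (k₀ + j + 1) :: high)).map
      (fun k : ℕ => c - (k : ZMod n)) = low.map (fun k : ℕ => c - (k : ZMod n)) ++
        (downRun (z : ZMod n) j ++ ((z : ZMod n) - (j : ZMod n) - 1) ::
          high.map fun k : ℕ => c - (k : ZMod n)) := by
    rw [List.map_append, List.map_append, List.map_cons, map_range'_eq_downRun, hz]
    congr 3
    push_cast; ring
  have hx : IsCycDecWord (low.map (fun k : ℕ => c - (k : ZMod n)) ++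
      (z : ZMod n) :: (downRun (z : ZMod n) j ++ high.map fun k : ℕ => c - (k : ZMod n))) := by
    rw [← ex]
    refine isCycDecWord_map_sub ?_ ?_ c
    · rw [List.pairwise_append, List.pairwise_cons, List.pairwise_append]
      refine ⟨hplow, ⟨?_, hprun, hphigh, ?_⟩, ?_⟩
      · intro k hk
        rw [List.mem_append, List.mem_range'_1, hhigh] at hk
        omega
      · intro k hk l hl
        rw [List.mem_range'_1] at hk
        rw [hhigh] at hl
        omega
      · intro k hk l hl
        rw [List.mem_cons, List.mem_append, List.mem_range'_1, hhigh] at hl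
        rw [hlow] at hk
        omega
    · intro k hk
      rw [List.mem_append, List.mem_cons, List.mem_append, List.mem_range'_1, hhigh] at hk
      rcases hk with hk | hk
      · have h1 := hlow0 k hk
        rw [hlow] at hk
        omega
      · omega
  have hy : IsCycDecWord (low.map (fun k : ℕ => c - (k : ZMod n)) ++
      (downRun (z : ZMod n) j ++ ((z : ZMod n) - (j : ZMod n) - 1) ::
        high.map fun k : ℕ => c - (k : ZMod n))) := by
    rw [← ey]
    refine isCycDecWord_map_sub ?_ ?_ c
    · rw [List.pairwise_append, List.pairwise_append, List.pairwise_cons]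
      refine ⟨hplow, ⟨hprun, ⟨?_, hphigh⟩, ?_⟩, ?_⟩
      · intro k hk
        rw [hhigh] at hk
        omega
      · intro k hk l hl
        rw [List.mem_range'_1] at hk
        rw [List.mem_cons, hhigh] at hl
        omega
      · intro k hk l hl
        rw [List.mem_append, List.mem_cons, List.mem_range'_1, hhigh] at hl
        rw [hlow] at hk
        omega
    · intro k hk
      rw [List.mem_append, List.mem_append, List.mem_cons, List.mem_range'_1, hhigh] at hk
      rcases hk with hk | hk
      · have h1 := hlow0 k hk
        rw [hlow] at hk
        omega
      · omega
  have hset : (low.map (fun k : ℕ => c - (k : ZMod n)) ++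
      (z : ZMod n) :: (downRun (z : ZMod n) j ++
        high.map fun k : ℕ => c - (k : ZMod n))).toFinset = A := by
    rw [← ex]
    ext t
    rw [List.mem_toFinset, List.mem_map]
    constructor
    · rintro ⟨k, hk, rfl⟩
      rw [List.mem_append, List.mem_cons, List.mem_append, List.mem_range'_1, hhigh, hlow] at hk
      rcases hk with hk | rfl | hk | hk
      · exact hk.2
      · exact hrun' _ le_rfl (by omega)
      · exact hrun' _ (by omega) (by omega)
      · exact hk.2.2
    · intro ht
      have e : c - ((c - t).val : ZMod n) = t := by simp
      refine ⟨(c - t).val, ?_, e⟩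
      have hlt := ZMod.val_lt (c - t)
      rw [List.mem_append, List.mem_cons, List.mem_append, List.mem_range'_1, hhigh, hlow, e]
      have hne : (c - t).val ≠ k₀ + j + 1 := by
        intro h
        rw [h, hend'] at e
        exact hend (e ▸ ht)
      simp only [ht, and_true]
      omega
  have hxw := (show IsCycDecOn A (wordProd _) from ⟨_, hx, rfl, hset⟩).isCycFun.eq hA.isCycFun
  have hp : (low.map fun k : ℕ => c - (k : ZMod n)).length <
      (low.map (fun k : ℕ => c - (k : ZMod n)) ++
      (z : ZMod n) :: (downRun (z : ZMod n) j ++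
        high.map fun k : ℕ => c - (k : ZMod n))).length := by simp
  have hdel := hx.isCycDecOn_eraseIdx hp rfl
  rw [eraseIdx_append_cons] at hdel
  have hv' : wordProd (low.map (fun k : ℕ => c - (k : ZMod n)) ++ (downRun (z : ZMod n) j ++
        high.map fun k : ℕ => c - (k : ZMod n))) = v := by
    refine IsCycFun.eq (A := A.erase (z : ZMod n)) ?_ hv.isCycFun
    have := hdel.isCycFun
    rw [hset] at this
    simpa using this
  have hlenx := isReducedWord_iff.mp hx.1
  rw [hxw, h.2] at hlenx
  exact ⟨_, _, _, ⟨hx.1, firstHit_downRun j _ _ _ (isReducedWordOf_iff.mpr ⟨hv', by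
    simp only [List.length_append, List.length_cons] at hlenx ⊢
    omega⟩) hy.1⟩, hx, hxw, hy, rfl⟩

end Run

theorem theoremt (n : ℕ) (hn : 2 ≤ n) (v : AffinePerm n) (r : ℤ) (m : ℕ) (α : Fin m → ℕ) :
    -- the map used on the factors is induced by the affine Little algorithm on words
    (∀ v₀ w₀ : AffinePerm n, IsCycDec v₀ → IsCycDec w₀ → BruhatCovers v₀ w₀ →
      (∃! u, CycPhi v₀ w₀ u) ∧
      (∀ u, CycLittle v₀ w₀ u → CycPhi v₀ w₀ u) ∧
      (affLength w₀ + 1 < n → ∃ u, CycLittle v₀ w₀ u)) ∧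
    -- the algorithm is well defined: the initial index and each step are uniquely determined
    (∀ D ∈ alphaDecomps α (rightCovers r v), ∃! i, IsLittleState α v ⟨D, i⟩) ∧
    (∀ S : LittleState n m, IsLittleState α v S →
      ∃! T : LittleState n m, LittleStep α v S T) ∧
    -- it terminates on every input, and the output map is a bijection
    ∃ Φ : (Fin m → AffinePerm n) → (Fin m → AffinePerm n),
      Set.BijOn Φ (alphaDecomps α (rightCovers r v)) (alphaDecomps α (leftCovers r v)) ∧
      ∀ D ∈ alphaDecomps α (rightCovers r v), ∀ E, LittleOutput α v D E ↔ E = Φ D := by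
  have : Fact (1 < n) := ⟨hn⟩
  exact ⟨fun v₀ w₀ _ hw h => ⟨existsUnique_cycPhi hw h, fun u hu => hu.cycPhi,
      fun hlen => exists_cycLittle hw h hlen⟩,
    fun D hD => existsUnique_isLittleState hD, fun S hS => existsUnique_littleStep hS,
    exists_bijOn_littleOutput α v r⟩
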